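/- Let $d\ge 2$. Let $2_*:=\frac{2d}{d+2}$ if $d\ge 3$, and let $2_*\in(1,2)$ be arbitrary but fixed if $d=2$. Assume: (A) $U\subset\mathbb R^d$ is a bounded open set; $A=(a_{ij})_{1\le i,j\le d}$ is a (possibly non-symmetric) matrix of functions in $L^\infty(U)$ such that for some constants $\lambda,\Lambda>0$, $\langle A(x)\xi,\xi\rangle\ge\lambda\|\xi\|^2$ and $\max_{i,j}|a_{ij}(x)|\le\Lambda$ for all $x\in U$, $\xi\in\mathbb R^d$; $B\in L^2(U,\mathbb R^d)$ satisfies $\operatorname{div}B\le 0$ weakly in $U$, i.e. $\int_U\langle B,\nabla\varphi\rangle\,dx\ge 0$ for all $\varphi\in C_0^\infty(U)$ with $\varphi\ge 0$; $c\in L^{2_*}(U)$ with $c\ge 0$; and $\alpha\in[0,\infty)$. Consider the Dirichlet problem $$-\operatorname{div}(A\nabla u)+\langle B,\nabla u\rangle+(c+\alpha)u=f-\operatorname{div}F\ \text{ in }U,\qquad u=0\ \text{ on }\partial U. \tag{1}$$ A weak solution of (1) is a function $u\in H^{1,2}_0(U)$ (the closure of $C_0^\infty(U)$ in $H^{1,2}(U)$,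 with norm $\|u\|_{H^{1,2}_0(U)}=(\|u\|_{L^2(U)}^2+\sum_{i}\|\partial_iu\|_{L^2(U)}^2)^{1/2}$) such that for every $\varphi\in C_0^\infty(U)$ $$\int_U\langle A\nabla u,\nabla\varphi\rangle+\big(\langle B,\nabla u\rangle+(c+\alpha)u\big)\varphi\,dx=\int_U f\varphi+\langle F,\nabla\varphi\rangle\,dx,$$ where both integrals are well defined in $\mathbb R$. For vector fields, $\|F\|_{L^p(U)}:=\big\|\,\|F\|\,\big\|_{L^p(U)}$. Then there are constants $C_1>0$, depending only on $\lambda$, $d$, $|U|$ (and, if $d=2$, on the fixed exponent $2_*$), and $C_2=C_2(q)>0$ for each $q\in(d/2,\infty)$, depending only on $\lambda$, $d$, $q$ and $|U|$, such that the following hold. (i) Let $f\in L^{2_*}(U)$ and $F\in L^2(U,\mathbb R^d)$. Then (1) has a unique (up to equality a.e.) weak solution $u$, and $$\|u\|_{H^{1,2}_0(U)}\le C_1\big(\|f\|_{L^{2_*}(U)}+\|F\|_{L^2(U)}\big).$$ Moreover, if $q\in(d/2,\infty)$ with $q\ge 2_*$, $f\in L^q(U)$ and $F\in L^{2q}(U,\mathbb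 R^d)$, then $u\in L^\infty(U)$ and $$\|u\|_{L^\infty(U)}\le C_2(q)\big(\|f\|_{L^q(U)}+\|F\|_{L^{2q}(U)}\big).$$ (ii) Let $\alpha>0$, $r\in[1,\infty]$, $q\in(d/2,\infty)$, $f\in L^r(U)\cap L^{2_*}(U)$ and $F\in L^{2q}(U,\mathbb R^d)$. Then the weak solution $u$ of (1) satisfies $u\in L^r(U)$ and $$\|u\|_{L^r(U)}\le\alpha^{-1}\|f\|_{L^r(U)}+C_2(q)\,|U|^{1/r}\,\|F\|_{L^{2q}(U)},$$ with the same constant $C_2(q)$ as in (i), and $|U|^{1/\infty}:=1$. -/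

import Mathlib

open MeasureTheory
open scoped ENNReal NNReal ContDiff

noncomputable section

/-- `C_0^∞(U)`: smooth functions with compact support contained in `U`
(extended by zero to the whole space). -/
structure IsTestFunction {d : ℕ} (U : Set (EuclideanSpace ℝ (Fin d)))
    (φ : EuclideanSpace ℝ (Fin d) → ℝ) : Prop where
  contDiff : ContDiff ℝ ∞ φ
  hasCompactSupport : HasCompactSupport φ
  tsupport_subset : tsupport φ ⊆ U

/-- `G` is a weak gradient of `u` on `U`: both are locally integrable on `U` and
`∫_U u ∂ᵢφ dx = - ∫_U Gᵢ φ dx` for every test function `φ` and every index `i`. -/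
structure IsWeakGradient {d : ℕ} (U : Set (EuclideanSpace ℝ (Fin d)))
    (u : EuclideanSpace ℝ (Fin d) → ℝ)
    (G : EuclideanSpace ℝ (Fin d) → EuclideanSpace ℝ (Fin d)) : Prop where
  locallyIntegrableOn : LocallyIntegrableOn u U
  locallyIntegrableOn_grad : LocallyIntegrableOn G U
  integral_eq : ∀ φ : EuclideanSpace ℝ (Fin d) → ℝ, IsTestFunction U φ → ∀ i : Fin d,
    ∫ x in U, u x * gradient φ x i = - ∫ x in U, G x i * φ x

open Classical in
/-- The weak gradient `∇u` on `U` (unique almost everywhere on the open set `U`);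
it is `0` if `u` has no weak gradient. -/
def weakGradient {d : ℕ} (U : Set (EuclideanSpace ℝ (Fin d)))
    (u : EuclideanSpace ℝ (Fin d) → ℝ) :
    EuclideanSpace ℝ (Fin d) → EuclideanSpace ℝ (Fin d) :=
  if h : ∃ G, IsWeakGradient U u G then h.choose else 0

/-- `u ∈ H^{1,2}(U)`: `u ∈ L²(U)` has weak first partial derivatives, and they are in `L²(U)`. -/
def MemH1 {d : ℕ} (U : Set (EuclideanSpace ℝ (Fin d)))
    (u : EuclideanSpace ℝ (Fin d) → ℝ) : Prop :=
  MemLp u 2 (volume.restrict U) ∧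
    ∃ G, IsWeakGradient U u G ∧ MemLp G 2 (volume.restrict U)

/-- The norm `(‖u‖²_{L²(U)} + ∑ᵢ ‖∂ᵢu‖²_{L²(U)})^{1/2}` of `H^{1,2}(U)`. -/
def h1Norm {d : ℕ} (U : Set (EuclideanSpace ℝ (Fin d)))
    (u : EuclideanSpace ℝ (Fin d) → ℝ) : ℝ≥0∞ :=
  (eLpNorm u 2 (volume.restrict U) ^ 2
    + ∑ i : Fin d, eLpNorm (fun x => weakGradient U u x i) 2 (volume.restrict U) ^ 2) ^ (1 / 2 : ℝ)

/-- `u ∈ H^{1,2}_0(U)`, the closure of `C_0^∞(U)` in `H^{1,2}(U)`. -/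
def MemH10 {d : ℕ} (U : Set (EuclideanSpace ℝ (Fin d)))
    (u : EuclideanSpace ℝ (Fin d) → ℝ) : Prop :=
  MemH1 U u ∧ ∀ ε : ℝ≥0∞, 0 < ε → ∃ φ, IsTestFunction U φ ∧ h1Norm U (fun x => u x - φ x) < ε

/-- `s = 2_*`: it is `2d/(d+2)` if `d ≥ 3`, and an arbitrary number in `(1,2)` if `d = 2`. -/
def IsLowerSobolevExponent (d : ℕ) (s : ℝ) : Prop :=
  (3 ≤ d ∧ s = 2 * (d : ℝ) / ((d : ℝ) + 2)) ∨ (d = 2 ∧ 1 < s ∧ s < 2)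

/-- The standing assumptions on the domain and the coefficients, with `s = 2_*` and
ellipticity constant `lam`; the dimension `d ≥ 2` and the constant `α` are treated separately. -/
structure CoefficientAssumptions {d : ℕ} (s lam : ℝ) (U : Set (EuclideanSpace ℝ (Fin d)))
    (A : EuclideanSpace ℝ (Fin d) → Matrix (Fin d) (Fin d) ℝ)
    (B : EuclideanSpace ℝ (Fin d) → EuclideanSpace ℝ (Fin d))
    (c : EuclideanSpace ℝ (Fin d) → ℝ) : Prop where
  isOpen : IsOpen U
  isBounded : Bornology.IsBounded U
  memLp_A : ∀ i j, MemLp (fun x => A x i j) ∞ (volume.restrict U)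
  elliptic : ∀ x ∈ U, ∀ ξ : EuclideanSpace ℝ (Fin d),
    lam * ‖ξ‖ ^ 2 ≤ inner ℝ ((A x).toEuclideanLin ξ) ξ
  bounded_A : ∃ Lam : ℝ, 0 < Lam ∧ ∀ x ∈ U, ∀ i j, |A x i j| ≤ Lam
  memLp_B : MemLp B 2 (volume.restrict U)
  div_B_nonpos : ∀ φ : EuclideanSpace ℝ (Fin d) → ℝ, IsTestFunction U φ → (∀ x, 0 ≤ φ x) →
    0 ≤ ∫ x in U, inner ℝ (B x) (gradient φ x)
  memLp_c : MemLp c (ENNReal.ofReal s) (volume.restrict U)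
  c_nonneg : ∀ᵐ x ∂(volume.restrict U), 0 ≤ c x

/-- `u` is a weak solution of `-div(A∇u) + ⟨B,∇u⟩ + (c+α)u = f - div F` in `U`, `u = 0` on `∂U`:
`u ∈ H^{1,2}_0(U)`, and for every test function `φ` both integrals of the weak formulation
are well defined and they agree. -/
def IsWeakSolution {d : ℕ} (U : Set (EuclideanSpace ℝ (Fin d)))
    (A : EuclideanSpace ℝ (Fin d) → Matrix (Fin d) (Fin d) ℝ)
    (B : EuclideanSpace ℝ (Fin d) → EuclideanSpace ℝ (Fin d))
    (c : EuclideanSpace ℝ (Fin d) → ℝ) (α : ℝ)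
    (f : EuclideanSpace ℝ (Fin d) → ℝ)
    (F : EuclideanSpace ℝ (Fin d) → EuclideanSpace ℝ (Fin d))
    (u : EuclideanSpace ℝ (Fin d) → ℝ) : Prop :=
  MemH10 U u ∧ ∀ φ : EuclideanSpace ℝ (Fin d) → ℝ, IsTestFunction U φ →
    IntegrableOn (fun x => inner ℝ ((A x).toEuclideanLin (weakGradient U u x)) (gradient φ x)
      + (inner ℝ (B x) (weakGradient U u x) + (c x + α) * u x) * φ x) U ∧
    IntegrableOn (fun x => f x * φ x + inner ℝ (F x) (gradient φ x)) U ∧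
    ∫ x in U, (inner ℝ ((A x).toEuclideanLin (weakGradient U u x)) (gradient φ x)
      + (inner ℝ (B x) (weakGradient U u x) + (c x + α) * u x) * φ x)
      = ∫ x in U, (f x * φ x + inner ℝ (F x) (gradient φ x))

end

/-! Since `B` is only in `L²` and `c` only in `L^{2_*}`, the lower-order term `⟨B,∇u⟩ + (c+α)u` is
merely integrable for `u ∈ H^{1,2}_0(U)`. The bilinear form is therefore not bounded on `H^{1,2}_0 ×
H^{1,2}_0`, and a solution is not an admissible test function. The signs of `div B` and `c`
compensate for this.

Existence. On test functions the form is coercive for the gradient norm, because `2⟨B,∇φ⟩φ =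
⟨B,∇(φ²)⟩` has nonnegative integral. For a fixed test function it is bounded in the other argument.
This is the setting of Lions' projection theorem (`exists_approximate_solution`): two applications
of the Riesz theorem give a limit of gradients that solves the equation, with gradient norm at most
`N / lam`. The Poincaré inequality turns it into an element of `H^{1,2}_0(U)`.

A priori bounds. Any weak solution may be tested with `T(u)`, where `T` is smooth, bounded and
nondecreasing with bounded derivative and `T 0 = 0` (`WeakFormulation.comp`). If `S` is the
primitive of `T` vanishing at `0`, then `S ≥ 0` and `⟨B,∇u⟩T(u) = ⟨B,∇S(u)⟩` has nonnegative
integral; the `c`-term is nonnegative too. The resulting inequality `WeakFormulation.energy`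
contains neither `B` nor `c` nor the upper bound of `A`, whence the constants do not depend on them.

Boundedness. With `T` a smooth step between the levels `k` and `k + δ`, the energy and Sobolev
inequalities bound the measure of `{|u| > k + δ}` by a superlinear power of that of `{|u| > k}`; the
power exceeds one because `q > d/2`. Stampacchia's iteration then gives the `L^∞` bound. Applied to
a difference of solutions it also gives uniqueness.

Contraction. If `F = 0`, letting `δ → 0` gives `α ∫_{|u|>k} |u| ≤ ∫_{|u|>k} |f|` for all `k ≥ 0`,
and the layer-cake formula with Hölder's inequality turns this into `α ‖u‖_r ≤ ‖f‖_r`. For general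
`F`, let `v` solve the problem with `f` replaced by `0`: the contraction applies to `u - v` and the
`L^∞` bound to `v`, so `f` need not lie in `L^q`.

Functions in `H^{1,2}_0(U)` are handled as pairs `(u, G)` with `HasH10Gradient`, which avoids the
gradient obtained by choice. -/

/-! ### Test functions -/

namespace IsTestFunction

open InnerProductSpace

variable {d : ℕ} {U : Set (EuclideanSpace ℝ (Fin d))} {φ ψ : EuclideanSpace ℝ (Fin d) → ℝ}

lemma differentiable (h : IsTestFunction U φ) : Differentiable ℝ φ :=
  h.contDiff.differentiable (by simp)

lemma continuous (h : IsTestFunction U φ) : Continuous φ := h.contDiff.continuous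

lemma zero : IsTestFunction U (0 : EuclideanSpace ℝ (Fin d) → ℝ) :=
  ⟨contDiff_const, HasCompactSupport.zero, by simp [tsupport]⟩

lemma add (h : IsTestFunction U φ) (h' : IsTestFunction U ψ) : IsTestFunction U (φ + ψ) :=
  ⟨h.contDiff.add h'.contDiff, h.hasCompactSupport.add h'.hasCompactSupport,
    (tsupport_add φ ψ).trans (Set.union_subset h.tsupport_subset h'.tsupport_subset)⟩

lemma comp (h : IsTestFunction U φ) {T : ℝ → ℝ} (hT : ContDiff ℝ ∞ T) (hT0 : T 0 = 0) :
    IsTestFunction U (fun x => T (φ x)) :=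
  ⟨hT.comp h.contDiff, h.hasCompactSupport.comp_left hT0,
    (closure_mono (Function.support_comp_subset hT0 φ)).trans h.tsupport_subset⟩

lemma smul (h : IsTestFunction U φ) (a : ℝ) : IsTestFunction U (a • φ) :=
  h.comp (T := fun t => a * t) (by fun_prop) (by simp)

lemma sub (h : IsTestFunction U φ) (h' : IsTestFunction U ψ) : IsTestFunction U (φ - ψ) := by
  have := h.add (h'.smul (-1))
  rwa [neg_one_smul, ← sub_eq_add_neg] at this

lemma gradient_add (h : IsTestFunction U φ) (h' : IsTestFunction U ψ) :
    gradient (φ + ψ) = gradient φ + gradient ψ := by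
  ext1 x
  simp [gradient, fderiv_add (h.differentiable x) (h'.differentiable x)]

lemma gradient_smul (h : IsTestFunction U φ) (a : ℝ) :
    gradient (a • φ) = a • gradient φ := by
  ext1 x
  simp [gradient, fderiv_const_smul (h.differentiable x)]

lemma gradient_sub (h : IsTestFunction U φ) (h' : IsTestFunction U ψ) :
    gradient (φ - ψ) = gradient φ - gradient ψ := by
  ext1 x
  simp [gradient, fderiv_sub (h.differentiable x) (h'.differentiable x)]

lemma gradient_comp (h : IsTestFunction U φ) {T : ℝ → ℝ} (hT : ContDiff ℝ ∞ T) :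
    gradient (fun x => T (φ x)) = fun x => deriv T (φ x) • gradient φ x := by
  ext1 x
  have : fderiv ℝ (fun x => T (φ x)) x = deriv T (φ x) • fderiv ℝ φ x :=
    (((hT.differentiable (by simp)) (φ x)).hasDerivAt.comp_hasFDerivAt x
      (h.differentiable x).hasFDerivAt).fderiv
  simp [gradient, this]

lemma gradient_apply (i : Fin d) (x : EuclideanSpace ℝ (Fin d)) :
    gradient φ x i = fderiv ℝ φ x (EuclideanSpace.single i 1) := by
  rw [← inner_gradient_left, real_inner_comm, EuclideanSpace.inner_single_left]
  simp

lemma continuous_gradient (h : IsTestFunction U φ) : Continuous (gradient φ) :=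
  (toDual ℝ (EuclideanSpace ℝ (Fin d))).symm.continuous.comp
    (h.contDiff.continuous_fderiv (by simp))

lemma hasCompactSupport_gradient (h : IsTestFunction U φ) : HasCompactSupport (gradient φ) :=
  (h.hasCompactSupport.fderiv (𝕜 := ℝ)).comp_left (map_zero _)

lemma memLp (h : IsTestFunction U φ) (p : ℝ≥0∞) : MemLp φ p (volume.restrict U) :=
  (h.continuous.memLp_of_hasCompactSupport h.hasCompactSupport).restrict U

lemma memLp_gradient (h : IsTestFunction U φ) (p : ℝ≥0∞) :
    MemLp (gradient φ) p (volume.restrict U) :=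
  (h.continuous_gradient.memLp_of_hasCompactSupport h.hasCompactSupport_gradient).restrict U

lemma exists_bound (h : IsTestFunction U φ) : ∃ C, ∀ x, ‖φ x‖ ≤ C :=
  h.hasCompactSupport.exists_bound_of_continuous h.continuous

lemma apply_eq_zero (h : IsTestFunction U φ) {x : EuclideanSpace ℝ (Fin d)} (hx : x ∉ U) :
    φ x = 0 :=
  image_eq_zero_of_notMem_tsupport fun hx' => hx (h.tsupport_subset hx')

lemma gradient_eq_zero (h : IsTestFunction U φ) {x : EuclideanSpace ℝ (Fin d)} (hx : x ∉ U) :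
    gradient φ x = 0 := by
  have : fderiv ℝ φ x = 0 :=
    image_eq_zero_of_notMem_tsupport fun hx' => hx (h.tsupport_subset (tsupport_fderiv_subset ℝ hx'))
  simp [gradient, this]

lemma integral_by_parts (h : IsTestFunction U φ) (h' : IsTestFunction U ψ) (i : Fin d) :
    ∫ x in U, φ x * gradient ψ x i = - ∫ x in U, gradient φ x i * ψ x := by
  rw [setIntegral_eq_integral_of_forall_compl_eq_zero
      (fun x hx => by rw [h.apply_eq_zero hx, zero_mul]),
    setIntegral_eq_integral_of_forall_compl_eq_zero
      (fun x hx => by rw [h'.apply_eq_zero hx, mul_zero])]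
  simp only [gradient_apply]
  have e1 : Continuous fun x => fderiv ℝ φ x (EuclideanSpace.single i 1) :=
    (h.contDiff.continuous_fderiv (by simp)).clm_apply continuous_const
  have e2 : Continuous fun x => fderiv ℝ ψ x (EuclideanSpace.single i 1) :=
    (h'.contDiff.continuous_fderiv (by simp)).clm_apply continuous_const
  apply integral_mul_fderiv_eq_neg_fderiv_mul_of_integrable
  · exact (e1.mul h'.continuous).integrable_of_hasCompactSupport h'.hasCompactSupport.mul_left
  · exact (h.continuous.mul e2).integrable_of_hasCompactSupport h.hasCompactSupport.mul_right
  · exact (h.continuous.mul h'.continuous).integrable_of_hasCompactSupport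
      h.hasCompactSupport.mul_right
  · exact fun x _ => h.differentiable x
  · exact fun x _ => h'.differentiable x

end IsTestFunction

/-! ### Hölder-type bounds and convergence of integrals -/

section Holder

open Filter Topology

variable {α F F' : Type*} [MeasurableSpace α] {μ : Measure α}
  [NormedAddCommGroup F] [NormedAddCommGroup F']

/-- Pointwise domination replaces an exact product, so that inner products, scalar products and
matrix terms are all covered at once. -/
lemma lintegral_enorm_le_of_holder {f : α → F} {g : α → F'} {h : α → ℝ} {p q : ℝ≥0∞}
    [hpq : ENNReal.HolderTriple p q 1] (hf : AEStronglyMeasurable f μ)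
    (hg : AEStronglyMeasurable g μ) (hb : ∀ᵐ x ∂μ, ‖h x‖ ≤ ‖f x‖ * ‖g x‖) :
    ∫⁻ x, ‖h x‖ₑ ∂μ ≤ eLpNorm f p μ * eLpNorm g q μ := by
  have key : eLpNorm (fun x => ‖f x‖ * ‖g x‖) 1 μ
      ≤ (1 : ℝ≥0) * eLpNorm (fun x => ‖f x‖) p μ * eLpNorm (fun x => ‖g x‖) q μ :=
    eLpNorm_le_eLpNorm_mul_eLpNorm_of_nnnorm hf.norm hg.norm (fun a b => a * b) 1
      (ae_of_all _ fun x => by simp)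
  rw [eLpNorm_norm, eLpNorm_norm, ENNReal.coe_one, one_mul, eLpNorm_one_eq_lintegral_enorm] at key
  refine le_trans (lintegral_mono_ae ?_) key
  filter_upwards [hb] with x hx
  rw [enorm_le_iff_norm_le]
  simpa using hx

lemma integrable_of_holder {f : α → F} {g : α → F'} {h : α → ℝ} {p q : ℝ≥0∞}
    [hpq : ENNReal.HolderTriple p q 1] (hf : MemLp f p μ)
    (hg : MemLp g q μ) (hh : AEStronglyMeasurable h μ)
    (hb : ∀ᵐ x ∂μ, ‖h x‖ ≤ ‖f x‖ * ‖g x‖) : Integrable h μ :=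
  ⟨hh, (lintegral_enorm_le_of_holder hf.1 hg.1 hb).trans_lt
    (ENNReal.mul_lt_top hf.2 hg.2)⟩

lemma abs_integral_le_of_holder {f : α → F} {g : α → F'} {h : α → ℝ} {p q : ℝ≥0∞}
    [hpq : ENNReal.HolderTriple p q 1] (hf : MemLp f p μ)
    (hg : MemLp g q μ) (hb : ∀ᵐ x ∂μ, ‖h x‖ ≤ ‖f x‖ * ‖g x‖) :
    |∫ x, h x ∂μ| ≤ (eLpNorm f p μ).toReal * (eLpNorm g q μ).toReal := by
  rw [← ENNReal.toReal_mul, ← Real.norm_eq_abs]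
  refine (norm_integral_le_lintegral_norm h).trans (ENNReal.toReal_mono
    (ENNReal.mul_lt_top hf.2 hg.2).ne ?_)
  simp only [ofReal_norm]
  exact lintegral_enorm_le_of_holder hf.1 hg.1 hb

/-- Dominated convergence with majorant `|C| ‖g‖`. It handles the term of the chain rule in which
only the multiplier `T'(φₙ) - T'(u)` tends to zero, almost everywhere. -/
lemma tendsto_eLpNorm_smul_zero {p : ℝ≥0∞} (hp0 : p ≠ 0) (hp : p ≠ ⊤) [NormedSpace ℝ F]
    {g : α → F} (hg : MemLp g p μ)
    {h : ℕ → α → ℝ} (hh : ∀ n, AEStronglyMeasurable (h n) μ) {C : ℝ} (hC : ∀ n x, ‖h n x‖ ≤ C)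
    (hlim : ∀ᵐ x ∂μ, Tendsto (fun n => h n x) atTop (𝓝 0)) :
    Tendsto (fun n => eLpNorm (fun x => h n x • g x) p μ) atTop (𝓝 0) := by
  have hpos : 0 < p.toReal := ENNReal.toReal_pos hp0 hp
  simp only [eLpNorm_eq_lintegral_rpow_enorm_toReal hp0 hp]
  have key : Tendsto (fun n => ∫⁻ x, ‖h n x • g x‖ₑ ^ p.toReal ∂μ) atTop
      (𝓝 (∫⁻ x, 0 ∂μ)) := by
    refine tendsto_lintegral_of_dominated_convergence'
      (fun x => (‖C • g x‖ₑ) ^ p.toReal) (fun n => ?_) (fun n => ae_of_all _ fun x => ?_) ?_ ?_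
    · exact ((hh n).smul hg.1).enorm.pow_const _
    · refine ENNReal.rpow_le_rpow ?_ hpos.le
      rw [enorm_le_iff_norm_le, norm_smul, norm_smul]
      gcongr
      exact (hC n x).trans (le_abs_self C)
    · exact (lintegral_rpow_enorm_lt_top_of_eLpNorm_lt_top hp0 hp (hg.const_smul C).2).ne
    · filter_upwards [hlim] with x hx
      have h1 : Tendsto (fun n => ‖h n x • g x‖ₑ) atTop (𝓝 ‖(0 : ℝ) • g x‖ₑ) :=
        (hx.smul_const (g x)).enorm
      have h2 := h1.ennrpow_const p.toReal
      simpa [hpos] using h2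
  have h3 := key.ennrpow_const (1 / p.toReal)
  simpa [hpos] using h3

variable [InnerProductSpace ℝ F]

lemma MeasureTheory.MemLp.integrable_real_inner {f g : α → F} {p q : ℝ≥0∞} [ENNReal.HolderTriple p q 1]
    (hf : MemLp f p μ) (hg : MemLp g q μ) :
    Integrable (fun x => inner ℝ (f x) (g x)) μ :=
  integrable_of_holder hf hg (hf.1.inner hg.1) (ae_of_all _ fun _ => norm_inner_le_norm _ _)

lemma tendsto_integral_inner {p q : ℝ≥0∞} [ENNReal.HolderTriple p q 1] {f : ℕ → α → F} {f₀ g : α → F}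
    (hf : ∀ n, MemLp (f n) p μ) (hf₀ : MemLp f₀ p μ) (hg : MemLp g q μ)
    (hlim : Tendsto (fun n => eLpNorm (f n - f₀) p μ) atTop (𝓝 0)) :
    Tendsto (fun n => ∫ x, inner ℝ (f n x) (g x) ∂μ) atTop (𝓝 (∫ x, inner ℝ (f₀ x) (g x) ∂μ)) := by
  rw [tendsto_iff_dist_tendsto_zero]
  have hlim' : Tendsto (fun n => (eLpNorm (f n - f₀) p μ).toReal * (eLpNorm g q μ).toReal)
      atTop (𝓝 0) := by
    have := ((ENNReal.continuousAt_toReal ENNReal.zero_ne_top).tendsto.comp hlim).mul_const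
      (eLpNorm g q μ).toReal
    simpa using this
  refine squeeze_zero (fun _ => dist_nonneg) (fun n => ?_) hlim'
  rw [Real.dist_eq, ← integral_sub ((hf n).integrable_real_inner hg) (hf₀.integrable_real_inner hg)]
  refine abs_integral_le_of_holder ((hf n).sub hf₀) hg (ae_of_all _ fun x => ?_)
  rw [← inner_sub_left]
  exact norm_inner_le_norm _ _

end Holder

/-! ### The space `H^{1,2}_0(U)` as a space of pairs -/

section H10

open Filter Topology

variable {d : ℕ} {U : Set (EuclideanSpace ℝ (Fin d))}

/-- `(u, G)` is the limit in `L²(U) × L²(U, ℝ^d)` of a sequence `(φₙ, ∇φₙ)` with test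
functions `φₙ`. -/
structure HasH10Gradient (U : Set (EuclideanSpace ℝ (Fin d))) (u : EuclideanSpace ℝ (Fin d) → ℝ)
    (G : EuclideanSpace ℝ (Fin d) → EuclideanSpace ℝ (Fin d)) : Prop where
  memLp : MemLp u 2 (volume.restrict U)
  memLp_grad : MemLp G 2 (volume.restrict U)
  exists_seq : ∃ φ : ℕ → EuclideanSpace ℝ (Fin d) → ℝ, (∀ n, IsTestFunction U (φ n)) ∧
    Tendsto (fun n => eLpNorm (φ n - u) 2 (volume.restrict U)) atTop (𝓝 0) ∧
    Tendsto (fun n => eLpNorm (gradient (φ n) - G) 2 (volume.restrict U)) atTop (𝓝 0)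

variable {u v : EuclideanSpace ℝ (Fin d) → ℝ}
  {G G' : EuclideanSpace ℝ (Fin d) → EuclideanSpace ℝ (Fin d)}

lemma IsTestFunction.hasH10Gradient {φ : EuclideanSpace ℝ (Fin d) → ℝ} (h : IsTestFunction U φ) :
    HasH10Gradient U φ (gradient φ) :=
  ⟨h.memLp 2, h.memLp_gradient 2, fun _ => φ, fun _ => h, by simp, by simp⟩

namespace HasH10Gradient

lemma sub (hu : HasH10Gradient U u G) (hv : HasH10Gradient U v G') :
    HasH10Gradient U (u - v) (G - G') := by
  obtain ⟨φ, hφ, h1, h2⟩ := hu.exists_seq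
  obtain ⟨ψ, hψ, h3, h4⟩ := hv.exists_seq
  refine ⟨hu.memLp.sub hv.memLp, hu.memLp_grad.sub hv.memLp_grad, fun n => φ n - ψ n,
    fun n => (hφ n).sub (hψ n), ?_, ?_⟩
  · have h13 := h1.add h3
    rw [add_zero] at h13
    refine tendsto_of_tendsto_of_tendsto_of_le_of_le tendsto_const_nhds h13
      (fun _ => zero_le) fun n => ?_
    have : φ n - ψ n - (u - v) = (φ n - u) - (ψ n - v) := by abel
    simp only [this]
    exact eLpNorm_sub_le (((hφ n).memLp 2).sub hu.memLp).1 (((hψ n).memLp 2).sub hv.memLp).1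
      (by norm_num)
  · have h24 := h2.add h4
    rw [add_zero] at h24
    refine tendsto_of_tendsto_of_tendsto_of_le_of_le tendsto_const_nhds h24
      (fun _ => zero_le) fun n => ?_
    have : gradient (φ n - ψ n) - (G - G') = (gradient (φ n) - G) - (gradient (ψ n) - G') := by
      rw [(hφ n).gradient_sub (hψ n)]; abel
    simp only [this]
    exact eLpNorm_sub_le (((hφ n).memLp_gradient 2).sub hu.memLp_grad).1
      (((hψ n).memLp_gradient 2).sub hv.memLp_grad).1 (by norm_num)

lemma congr_ae (hu : HasH10Gradient U u G) (h : v =ᵐ[volume.restrict U] u)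
    (h' : G' =ᵐ[volume.restrict U] G) : HasH10Gradient U v G' := by
  obtain ⟨φ, hφ, h1, h2⟩ := hu.exists_seq
  refine ⟨(memLp_congr_ae h).2 hu.memLp, (memLp_congr_ae h').2 hu.memLp_grad, φ, hφ, ?_, ?_⟩
  · convert h1 using 2 with n
    exact eLpNorm_congr_ae (EventuallyEq.rfl.sub h)
  · convert h2 using 2 with n
    exact eLpNorm_congr_ae (EventuallyEq.rfl.sub h')

lemma exists_seq_ae (hu : HasH10Gradient U u G) :
    ∃ φ : ℕ → EuclideanSpace ℝ (Fin d) → ℝ, (∀ n, IsTestFunction U (φ n)) ∧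
    Tendsto (fun n => eLpNorm (φ n - u) 2 (volume.restrict U)) atTop (𝓝 0) ∧
    Tendsto (fun n => eLpNorm (gradient (φ n) - G) 2 (volume.restrict U)) atTop (𝓝 0) ∧
    ∀ᵐ x ∂(volume.restrict U), Tendsto (fun n => φ n x) atTop (𝓝 (u x)) := by
  obtain ⟨φ, hφ, h1, h2⟩ := hu.exists_seq
  obtain ⟨ns, hns, h3⟩ := (tendstoInMeasure_of_tendsto_eLpNorm (by norm_num)
    (fun n => ((hφ n).memLp 2).1) hu.memLp.1 h1).exists_seq_tendsto_ae
  exact ⟨fun n => φ (ns n), fun n => hφ _, h1.comp hns.tendsto_atTop, h2.comp hns.tendsto_atTop,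
    h3⟩

/-- Both sides of the integration by parts formula are `L²` pairings with a fixed function, hence
pass to the limit along the approximating test functions. -/
lemma isWeakGradient [IsFiniteMeasure (volume.restrict U)] (hu : HasH10Gradient U u G) :
    IsWeakGradient U u G := by
  have i1 : IntegrableOn u U := hu.memLp.integrable (by norm_num)
  have i2 : IntegrableOn G U := hu.memLp_grad.integrable (by norm_num)
  refine ⟨i1.locallyIntegrableOn, i2.locallyIntegrableOn, fun ψ hψ i => ?_⟩
  obtain ⟨φ, hφ, h1, h2⟩ := hu.exists_seq
  have e1 : MemLp (fun x => gradient ψ x i) 2 (volume.restrict U) :=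
    (EuclideanSpace.proj i : EuclideanSpace ℝ (Fin d) →L[ℝ] ℝ).comp_memLp' (hψ.memLp_gradient 2)
  -- Pairing with the vector field `ψ eᵢ` expresses the integral of the `i`-th coordinate as an `L²`
  -- inner product of vector fields.
  have e2 : MemLp (fun x => ψ x • EuclideanSpace.single i (1 : ℝ)) 2 (volume.restrict U) := by
    refine (hψ.memLp 2).of_le (hψ.continuous.smul continuous_const).aestronglyMeasurable
      (ae_of_all _ fun x => by simp [norm_smul])
  have t1 := tendsto_integral_inner (fun n => (hφ n).memLp 2) hu.memLp e1 h1
  have t2 := (tendsto_integral_inner (fun n => (hφ n).memLp_gradient 2) hu.memLp_grad e2 h2).neg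
  have key : ∀ n, ∫ x in U, inner ℝ (φ n x) (gradient ψ x i)
      = - ∫ x in U, inner ℝ (gradient (φ n) x) (ψ x • EuclideanSpace.single i (1 : ℝ)) := by
    intro n
    convert (hφ n).integral_by_parts hψ i using 4 with x
    · simp [mul_comm]
    · rw [inner_smul_right, EuclideanSpace.inner_single_right]; simp [mul_comm]
  simp only [key] at t1
  convert tendsto_nhds_unique t1 t2 using 4 with x
  · simp [mul_comm]
  · simp [inner_smul_right, EuclideanSpace.inner_single_right, mul_comm]

end HasH10Gradient

/-- The fundamental lemma of the calculus of variations, coordinate by coordinate. It allows the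
chosen `weakGradient` to be exchanged for any concrete weak gradient. -/
lemma IsWeakGradient.ae_eq (hU : IsOpen U) (h : IsWeakGradient U u G)
    (h' : IsWeakGradient U u G') : G =ᵐ[volume.restrict U] G' := by
  have hi : ∀ i : Fin d, ∀ᵐ x, x ∈ U → G x i - G' x i = 0 := by
    intro i
    have p1 : ∀ {K : EuclideanSpace ℝ (Fin d) → EuclideanSpace ℝ (Fin d)},
        LocallyIntegrableOn K U → LocallyIntegrableOn (fun x => K x i) U := by
      intro K hK x hx
      exact (hK x hx).imp fun s hs =>
        ⟨hs.1, (EuclideanSpace.proj i : EuclideanSpace ℝ (Fin d) →L[ℝ] ℝ).integrable_comp hs.2⟩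
    have q1 := p1 h.locallyIntegrableOn_grad
    have q2 := p1 h'.locallyIntegrableOn_grad
    have key : ∀ {K : EuclideanSpace ℝ (Fin d) → ℝ}, LocallyIntegrableOn K U →
        ∀ φ : EuclideanSpace ℝ (Fin d) → ℝ, IsTestFunction U φ →
        Integrable (fun x => K x * φ x) := by
      intro K hK φ hφ
      have := (hK.mono_set hφ.tsupport_subset).integrableOn_isCompact hφ.hasCompactSupport
      have i1 := this.mul_continuousOn hφ.continuous.continuousOn hφ.hasCompactSupport
      rw [integrableOn_iff_integrable_of_support_subset] at i1
      · exact i1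
      · exact (Function.support_mul_subset_right _ _).trans (subset_tsupport φ)
    refine hU.ae_eq_zero_of_integral_contDiff_smul_eq_zero (q1.sub q2) fun φ c1 c2 c3 => ?_
    have hφ : IsTestFunction U φ := ⟨c1, c2, c3⟩
    have e := (h.integral_eq φ hφ i).symm.trans (h'.integral_eq φ hφ i)
    rw [neg_inj, setIntegral_eq_integral_of_forall_compl_eq_zero
      (fun x hx => by rw [hφ.apply_eq_zero hx, mul_zero]),
      setIntegral_eq_integral_of_forall_compl_eq_zero
      (fun x hx => by rw [hφ.apply_eq_zero hx, mul_zero])] at e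
    have e' : ∫ x, (G x i * φ x - G' x i * φ x) = 0 := by
      rw [integral_sub (key q1 φ hφ) (key q2 φ hφ), e, sub_self]
    rw [← e']
    congr 1 with x
    simp; ring
  rw [Filter.EventuallyEq, ae_restrict_iff' hU.measurableSet]
  filter_upwards [ae_all_iff.2 hi] with x hx hxU
  ext i
  exact sub_eq_zero.1 (hx i hxU)

lemma IsWeakGradient.weakGradient_ae_eq (hU : IsOpen U) (h : IsWeakGradient U u G) :
    weakGradient U u =ᵐ[volume.restrict U] G := by
  have hex : ∃ G, IsWeakGradient U u G := ⟨G, h⟩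
  rw [weakGradient, dif_pos hex]
  exact hex.choose_spec.ae_eq hU h

end H10

/-! ### The `H^{1,2}` norm, the two descriptions of `H^{1,2}_0(U)`, and the chain rule -/

section H10Norm

open Filter Topology

variable {d : ℕ} {U : Set (EuclideanSpace ℝ (Fin d))} {u v : EuclideanSpace ℝ (Fin d) → ℝ}
  {G G' : EuclideanSpace ℝ (Fin d) → EuclideanSpace ℝ (Fin d)}

lemma eLpNorm_le_sum_eLpNorm_coord {μ : Measure (EuclideanSpace ℝ (Fin d))}
    (hG : AEStronglyMeasurable G μ) :
    eLpNorm G 2 μ ≤ ∑ i, eLpNorm (fun x => G x i) 2 μ := by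
  have hm : ∀ i : Fin d, AEStronglyMeasurable (fun x => G x i) μ := fun i =>
    (EuclideanSpace.proj i : EuclideanSpace ℝ (Fin d) →L[ℝ] ℝ).continuous.comp_aestronglyMeasurable
      hG
  calc eLpNorm G 2 μ ≤ eLpNorm (∑ i, fun x => ‖G x i‖) 2 μ := by
        refine eLpNorm_mono fun x => ?_
        have h0 : 0 ≤ ∑ i, ‖G x i‖ := Finset.sum_nonneg fun _ _ => norm_nonneg _
        rw [Finset.sum_apply, Real.norm_of_nonneg h0, EuclideanSpace.norm_eq]
        refine Real.sqrt_le_iff.2 ⟨h0, Finset.sum_sq_le_sq_sum_of_nonneg fun _ _ => norm_nonneg _⟩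
    _ ≤ ∑ i, eLpNorm (fun x => ‖G x i‖) 2 μ :=
        eLpNorm_sum_le (fun i _ => (hm i).norm) (by norm_num)
    _ = ∑ i, eLpNorm (fun x => G x i) 2 μ := by simp only [eLpNorm_norm]

lemma eLpNorm_coord_le {μ : Measure (EuclideanSpace ℝ (Fin d))} (i : Fin d) :
    eLpNorm (fun x => G x i) 2 μ ≤ eLpNorm G 2 μ :=
  eLpNorm_mono fun _ => PiLp.norm_apply_le _ i

lemma eLpNorm_le_h1Norm : eLpNorm u 2 (volume.restrict U) ≤ h1Norm U u := by
  rw [h1Norm, one_div, ENNReal.le_rpow_inv_iff (by norm_num)]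
  norm_cast
  exact le_self_add

lemma eLpNorm_weakGradient_coord_le_h1Norm (i : Fin d) :
    eLpNorm (fun x => weakGradient U u x i) 2 (volume.restrict U) ≤ h1Norm U u := by
  rw [h1Norm, one_div, ENNReal.le_rpow_inv_iff (by norm_num)]
  norm_cast
  refine le_trans ?_ le_add_self
  exact Finset.single_le_sum
    (f := fun i => eLpNorm (fun x => weakGradient U u x i) 2 (volume.restrict U) ^ 2)
    (fun _ _ => zero_le) (Finset.mem_univ i)

lemma ENNReal.sum_sq_le_sq_sum {ι : Type*} (s : Finset ι) (f : ι → ℝ≥0∞) :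
    ∑ i ∈ s, f i ^ 2 ≤ (∑ i ∈ s, f i) ^ 2 := by
  rw [pow_two, Finset.sum_mul]
  refine Finset.sum_le_sum fun i hi => ?_
  rw [pow_two]
  gcongr
  exact Finset.single_le_sum (fun _ _ => zero_le) hi

/-- Bounding the `ℓ²` norm of the pieces by their sum is crude, but only the dependence of the
constant on `d` matters. -/
lemma h1Norm_le (hG : weakGradient U u =ᵐ[volume.restrict U] G) :
    h1Norm U u ≤ eLpNorm u 2 (volume.restrict U) + d * eLpNorm G 2 (volume.restrict U) := by
  have h1 : ∀ i : Fin d, eLpNorm (fun x => weakGradient U u x i) 2 (volume.restrict U)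
      ≤ eLpNorm G 2 (volume.restrict U) := fun i => by
    rw [← eLpNorm_congr_ae hG]
    exact eLpNorm_coord_le i
  have h2 : ∑ i : Fin d, eLpNorm (fun x => weakGradient U u x i) 2 (volume.restrict U)
      ≤ d * eLpNorm G 2 (volume.restrict U) := by
    refine (Finset.sum_le_sum fun i _ => h1 i).trans (by simp)
  rw [h1Norm, one_div, ENNReal.rpow_inv_le_iff (by norm_num)]
  norm_cast
  calc _ ≤ eLpNorm u 2 (volume.restrict U) ^ 2
        + (d * eLpNorm G 2 (volume.restrict U)) ^ 2 := by
        gcongr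
        exact (ENNReal.sum_sq_le_sq_sum _ _).trans (by gcongr)
    _ ≤ _ := by
        rw [add_sq]
        gcongr
        exact le_self_add

lemma IsWeakGradient.sub (hu : IsWeakGradient U u G) (hv : IsWeakGradient U v G')
    (mu : MemLp u 2 (volume.restrict U)) (mv : MemLp v 2 (volume.restrict U))
    (mG : MemLp G 2 (volume.restrict U)) (mG' : MemLp G' 2 (volume.restrict U)) :
    IsWeakGradient U (u - v) (G - G') := by
  refine ⟨hu.1.sub hv.1, hu.2.sub hv.2, fun φ hφ i => ?_⟩
  have hp := fun {K : EuclideanSpace ℝ (Fin d) → EuclideanSpace ℝ (Fin d)}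
    (hK : MemLp K 2 (volume.restrict U)) =>
    (EuclideanSpace.proj i : EuclideanSpace ℝ (Fin d) →L[ℝ] ℝ).comp_memLp' hK
  have e := hp (hφ.memLp_gradient 2)
  have e1 := mu.integrable_mul e
  have e2 := mv.integrable_mul e
  have e3 := (hp mG).integrable_mul (hφ.memLp 2)
  have e4 := (hp mG').integrable_mul (hφ.memLp 2)
  have s1 := integral_sub e1 e2
  have s2 := integral_sub e3 e4
  have h1 := hu.integral_eq φ hφ i
  have h2 := hv.integral_eq φ hφ i
  simp only [Pi.sub_apply, PiLp.sub_apply, sub_mul] at s1 s2 ⊢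
  refine s1.trans ((congrArg₂ (· - ·) h1 h2).trans ?_)
  refine Eq.trans ?_ (congrArg Neg.neg s2).symm
  simp [add_comm, sub_eq_add_neg]

/-- Together with `HasH10Gradient.memH10` this identifies the closure in the `H^{1,2}` norm with the
limits of pairs `(φₙ, ∇φₙ)`. -/
lemma MemH10.hasH10Gradient [IsFiniteMeasure (volume.restrict U)] (hU : IsOpen U)
    (h : MemH10 U u) : HasH10Gradient U u (weakGradient U u) := by
  obtain ⟨⟨mu, G, hG, mG⟩, happ⟩ := h
  have hwG := hG.weakGradient_ae_eq hU
  suffices HasH10Gradient U u G from this.congr_ae EventuallyEq.rfl hwG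
  have hpos : ∀ n : ℕ, (0 : ℝ≥0∞) < ((n : ℝ≥0∞) + 1)⁻¹ := fun n => by
    rw [ENNReal.inv_pos]; finiteness
  choose φ hφ hlt using fun n : ℕ => happ _ (hpos n)
  have hlim : Tendsto (fun n : ℕ => ((n : ℝ≥0∞) + 1)⁻¹) atTop (𝓝 0) := by
    have := (tendsto_add_atTop_iff_nat (f := fun n : ℕ => ((n : ℝ≥0∞))⁻¹) 1).2
      ENNReal.tendsto_inv_nat_nhds_zero
    simpa using this
  have hle : ∀ n, h1Norm U (u - φ n) ≤ ((n : ℝ≥0∞) + 1)⁻¹ := fun n => (hlt n).le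
  refine ⟨mu, mG, φ, hφ, ?_, ?_⟩
  · refine tendsto_of_tendsto_of_tendsto_of_le_of_le tendsto_const_nhds hlim
      (fun _ => zero_le) fun n => ?_
    simp only
    rw [eLpNorm_sub_comm]
    exact eLpNorm_le_h1Norm.trans (hle n)
  · have hlim' : Tendsto (fun n : ℕ => (d : ℝ≥0∞) * ((n : ℝ≥0∞) + 1)⁻¹) atTop (𝓝 0) := by
      simpa using ENNReal.Tendsto.const_mul hlim (Or.inr (ENNReal.natCast_ne_top d))
    refine tendsto_of_tendsto_of_tendsto_of_le_of_le tendsto_const_nhds hlim'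
      (fun _ => zero_le) fun n => ?_
    have hw : weakGradient U (u - φ n) =ᵐ[volume.restrict U] G - gradient (φ n) :=
      (hG.sub (hφ n).hasH10Gradient.isWeakGradient mu ((hφ n).memLp 2) mG
        ((hφ n).memLp_gradient 2)).weakGradient_ae_eq hU
    simp only
    rw [eLpNorm_sub_comm]
    refine (eLpNorm_le_sum_eLpNorm_coord (mG.sub ((hφ n).memLp_gradient 2)).1).trans ?_
    calc ∑ i, eLpNorm (fun x => (G - gradient (φ n)) x i) 2 (volume.restrict U)
        ≤ ∑ _i : Fin d, ((n : ℝ≥0∞) + 1)⁻¹ := by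
          refine Finset.sum_le_sum fun i _ => ?_
          refine le_trans (le_of_eq ?_) ((eLpNorm_weakGradient_coord_le_h1Norm i).trans (hle n))
          refine eLpNorm_congr_ae ?_
          filter_upwards [hw] with x hx
          rw [hx]
      _ = _ := by simp

namespace HasH10Gradient

lemma weakGradient_ae_eq [IsFiniteMeasure (volume.restrict U)] (hu : HasH10Gradient U u G) (hU : IsOpen U) :
    weakGradient U u =ᵐ[volume.restrict U] G :=
  hu.isWeakGradient.weakGradient_ae_eq hU

lemma memH10 [IsFiniteMeasure (volume.restrict U)] (hu : HasH10Gradient U u G)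
    (hU : IsOpen U) : MemH10 U u := by
  refine ⟨⟨hu.memLp, G, hu.isWeakGradient, hu.memLp_grad⟩, fun ε hε => ?_⟩
  obtain ⟨φ, hφ, h1, h2⟩ := hu.exists_seq
  have h3 : Tendsto (fun n => eLpNorm (φ n - u) 2 (volume.restrict U)
      + d * eLpNorm (gradient (φ n) - G) 2 (volume.restrict U)) atTop (𝓝 0) := by
    simpa using h1.add (ENNReal.Tendsto.const_mul h2 (Or.inr (ENNReal.natCast_ne_top d)))
  obtain ⟨n, hn⟩ := (h3.eventually (gt_mem_nhds hε)).exists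
  refine ⟨φ n, hφ n, lt_of_le_of_lt ?_ hn⟩
  have := h1Norm_le ((hu.sub (hφ n).hasH10Gradient).weakGradient_ae_eq hU)
  rw [eLpNorm_sub_comm, eLpNorm_sub_comm G] at this
  exact this

/-- The gradient error splits as `T'(φₙ)(∇φₙ - G) + (T'(φₙ) - T'(u))G`: the first term is small
because `T'` is bounded, the second by dominated convergence along an a.e. convergent subsequence.
The approximants have the explicit form `T ∘ φₙ`, so they inherit uniform bounds and signs from `T`.
-/
lemma exists_seq_comp (hu : HasH10Gradient U u G) {T : ℝ → ℝ} (hT : ContDiff ℝ ∞ T)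
    (hT0 : T 0 = 0) {L : ℝ} (hL : ∀ t, ‖deriv T t‖ ≤ L) :
    ∃ φ : ℕ → EuclideanSpace ℝ (Fin d) → ℝ, (∀ n, IsTestFunction U (φ n)) ∧
    (∀ n, IsTestFunction U (fun x => T (φ n x))) ∧
    Tendsto (fun n => eLpNorm ((fun x => T (φ n x)) - fun x => T (u x)) 2 (volume.restrict U))
      atTop (𝓝 0) ∧
    Tendsto (fun n => eLpNorm (gradient (fun x => T (φ n x)) - fun x => deriv T (u x) • G x) 2
      (volume.restrict U)) atTop (𝓝 0) ∧
    ∀ᵐ x ∂(volume.restrict U), Tendsto (fun n => T (φ n x)) atTop (𝓝 (T (u x))) := by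
  have hL0 : 0 ≤ L := (norm_nonneg _).trans (hL 0)
  have hTd : Differentiable ℝ T := hT.differentiable (by simp)
  have hlip : ∀ a b, ‖T a - T b‖ ≤ L * ‖a - b‖ := fun a b =>
    Convex.norm_image_sub_le_of_norm_deriv_le (fun x _ => hTd x) (fun x _ => hL x)
      convex_univ (Set.mem_univ b) (Set.mem_univ a)
  have hdc : Continuous (deriv T) := hT.continuous_deriv (by simp)
  have mdTu : AEStronglyMeasurable (fun x => deriv T (u x)) (volume.restrict U) :=
    hdc.comp_aestronglyMeasurable hu.memLp.1
  obtain ⟨φ, hφ, h1, h2, h3⟩ := hu.exists_seq_ae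
  refine ⟨φ, hφ, fun n => (hφ n).comp hT hT0, ?_, ?_, ?_⟩
  · have := ENNReal.Tendsto.const_mul h1 (Or.inr (ENNReal.ofReal_ne_top (r := L)))
    rw [mul_zero] at this
    refine tendsto_of_tendsto_of_tendsto_of_le_of_le tendsto_const_nhds this
      (fun _ => zero_le) fun n => ?_
    exact eLpNorm_le_mul_eLpNorm_of_ae_le_mul (ae_of_all _ fun x => hlip _ _) 2
  · have t1 := ENNReal.Tendsto.const_mul h2 (Or.inr (ENNReal.ofReal_ne_top (r := L)))
    have mdφ : ∀ n, AEStronglyMeasurable (fun x => deriv T (φ n x)) (volume.restrict U) :=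
      fun n => (hdc.comp (hφ n).continuous).aestronglyMeasurable
    have t2 := tendsto_eLpNorm_smul_zero (p := 2) (by norm_num) (by norm_num) hu.memLp_grad
      (h := fun n x => deriv T (φ n x) - deriv T (u x)) (C := L + L)
      (fun n => (mdφ n).sub mdTu)
      (fun n x => (norm_sub_le _ _).trans (add_le_add (hL _) (hL _)))
      (by
        filter_upwards [h3] with x hx
        have := ((hdc.tendsto (u x)).comp hx).sub_const (deriv T (u x))
        simpa using this)
    have t3 := t1.add t2
    rw [mul_zero, add_zero] at t3
    refine tendsto_of_tendsto_of_tendsto_of_le_of_le tendsto_const_nhds t3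
      (fun _ => zero_le) fun n => ?_
    have e : gradient (fun x => T (φ n x)) - (fun x => deriv T (u x) • G x)
        = (fun x => deriv T (φ n x) • (gradient (φ n) - G) x)
          + fun x => (deriv T (φ n x) - deriv T (u x)) • G x := by
      rw [(hφ n).gradient_comp hT]
      ext1 x
      simp only [Pi.sub_apply, Pi.add_apply, smul_sub, sub_smul]
      abel
    simp only [e]
    refine (eLpNorm_add_le ((mdφ n).smul (((hφ n).memLp_gradient 2).sub hu.memLp_grad).1)
      (((mdφ n).sub mdTu).smul hu.memLp_grad.1) (by norm_num)).trans (add_le_add ?_ le_rfl)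
    exact eLpNorm_le_mul_eLpNorm_of_ae_le_mul
      (ae_of_all _ fun x => (norm_smul_le _ _).trans
        (mul_le_mul_of_nonneg_right (hL _) (norm_nonneg _))) 2
  · filter_upwards [h3] with x hx
    exact (hT.continuous.tendsto (u x)).comp hx

/-- The chain rule in `H^{1,2}_0(U)`. -/
lemma comp (hu : HasH10Gradient U u G) {T : ℝ → ℝ} (hT : ContDiff ℝ ∞ T) (hT0 : T 0 = 0)
    {L : ℝ} (hL : ∀ t, ‖deriv T t‖ ≤ L) :
    HasH10Gradient U (fun x => T (u x)) (fun x => deriv T (u x) • G x) := by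
  have hlip : ∀ t, ‖T t‖ ≤ L * ‖t‖ := fun t => by
    simpa [hT0] using Convex.norm_image_sub_le_of_norm_deriv_le (f := T)
      (fun x _ => hT.differentiable (by simp) x) (fun x _ => hL x)
      convex_univ (Set.mem_univ 0) (Set.mem_univ t)
  have mTu : AEStronglyMeasurable (fun x => T (u x)) (volume.restrict U) :=
    hT.continuous.comp_aestronglyMeasurable hu.memLp.1
  have mdTu : AEStronglyMeasurable (fun x => deriv T (u x)) (volume.restrict U) :=
    (hT.continuous_deriv (by simp)).comp_aestronglyMeasurable hu.memLp.1
  obtain ⟨φ, -, hφ, h1, h2, -⟩ := hu.exists_seq_comp hT hT0 hL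
  exact ⟨hu.memLp.of_le_mul mTu (ae_of_all _ fun x => hlip (u x)),
    hu.memLp_grad.of_le_mul (c := L) (mdTu.smul hu.memLp_grad.1)
      (ae_of_all _ fun x => by rw [norm_smul]; gcongr; exact hL _), _, hφ, h1, h2⟩

end HasH10Gradient

end H10Norm

/-! ### The Sobolev inequality on `H^{1,2}_0(U)` -/

section Sobolev

open Filter Topology Module

variable {d : ℕ}

lemma IsTestFunction.eLpNorm_gradient_eq {U : Set (EuclideanSpace ℝ (Fin d))}
    {φ : EuclideanSpace ℝ (Fin d) → ℝ} (hU : MeasurableSet U) (h : IsTestFunction U φ) (p : ℝ≥0∞) :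
    eLpNorm (fderiv ℝ φ) p volume = eLpNorm (gradient φ) p (volume.restrict U) := by
  rw [← eLpNorm_indicator_eq_eLpNorm_restrict hU, Set.indicator_eq_self.2]
  · refine eLpNorm_congr_norm_ae (ae_of_all _ fun x => ?_)
    rw [gradient, LinearIsometryEquiv.norm_map]
  · intro x hx
    by_contra hxU
    exact hx (h.gradient_eq_zero hxU)

/-- The Gagliardo–Nirenberg–Sobolev inequality is used with gradient exponent `t` given by `1/t =
1/p + 1/d`. The hypotheses on `p` say that `1 ≤ t ≤ 2`, so Hölder's inequality on `U` replaces `t`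
by `2` at the cost of `|U|^{1/t - 1/2}`. This treats `d = 2` and `d ≥ 3` alike, and `U` enters only
through its volume. -/
lemma exists_sobolev_const_of_isTestFunction (hd : 2 ≤ d) (V : ℝ≥0) {p : ℝ} (hp : 2 ≤ p)
    (hpd : 1 / 2 - 1 / (d : ℝ) ≤ 1 / p) :
    ∃ C : ℝ≥0, ∀ U : Set (EuclideanSpace ℝ (Fin d)), MeasurableSet U → volume U = V →
      ∀ φ : EuclideanSpace ℝ (Fin d) → ℝ, IsTestFunction U φ →
      eLpNorm φ (ENNReal.ofReal p) (volume.restrict U)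
        ≤ C * eLpNorm (gradient φ) 2 (volume.restrict U) := by
  have hd' : (2 : ℝ) ≤ d := by exact_mod_cast hd
  have hd0 : (0 : ℝ) < 1 / d := by positivity
  have hd2 : 1 / (d : ℝ) ≤ 1 / 2 := by gcongr
  have hp0 : (0 : ℝ) < 1 / p := by positivity
  have hp2 : 1 / p ≤ 1 / 2 := by gcongr
  set t : ℝ := (1 / p + 1 / d)⁻¹ with ht
  have htinv : t⁻¹ = 1 / p + 1 / d := by rw [ht, inv_inv]
  have ht1 : 1 ≤ t := by rw [ht, one_le_inv₀ (by positivity)]; linarith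
  have ht2 : t ≤ 2 := by
    rw [ht]; refine inv_le_of_inv_le₀ (by norm_num) ?_
    linarith
  set C₀ : ℝ≥0 := SNormLESNormFDerivOfEqConst ℝ (volume : Measure (EuclideanSpace ℝ (Fin d)))
    t.toNNReal
  refine ⟨C₀ * V ^ (1 / t - 1 / 2), fun U hU hV φ hφ => ?_⟩
  have key := eLpNorm_le_eLpNorm_fderiv_of_eq (F := ℝ) (volume : Measure (EuclideanSpace ℝ (Fin d)))
    (hφ.contDiff.of_le (by simp)) hφ.hasCompactSupport (p := t.toNNReal) (p' := p.toNNReal)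
    (by rwa [Real.one_le_toNNReal]) (by simp; omega)
    (by
      rw [NNReal.coe_inv, Real.coe_toNNReal _ (by linarith), Real.coe_toNNReal _ (by linarith),
        htinv]
      simp)
  have hmono : eLpNorm (gradient φ) (t.toNNReal : ℝ≥0∞) (volume.restrict U)
      ≤ eLpNorm (gradient φ) 2 (volume.restrict U) * (V : ℝ≥0∞) ^ (1 / t - 1 / 2) := by
    have := eLpNorm_le_eLpNorm_mul_rpow_measure_univ (p := (t.toNNReal : ℝ≥0∞)) (q := 2)
      (by rw [← ENNReal.ofReal]; exact ENNReal.ofReal_le_of_le_toReal (by simpa using ht2))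
      (hφ.memLp_gradient 2).1
    simpa [hV, Real.coe_toNNReal _ (by linarith : (0 : ℝ) ≤ t)] using this
  calc eLpNorm φ (ENNReal.ofReal p) (volume.restrict U)
      ≤ eLpNorm φ (ENNReal.ofReal p) volume := eLpNorm_mono_measure _ Measure.restrict_le_self
    _ ≤ C₀ * eLpNorm (fderiv ℝ φ) (t.toNNReal : ℝ≥0∞) volume := key
    _ = C₀ * eLpNorm (gradient φ) (t.toNNReal : ℝ≥0∞) (volume.restrict U) := by
        rw [hφ.eLpNorm_gradient_eq hU]
    _ ≤ C₀ * (eLpNorm (gradient φ) 2 (volume.restrict U) * (V : ℝ≥0∞) ^ (1 / t - 1 / 2)) := by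
        gcongr
    _ = _ := by
        have h0 : 0 ≤ 1 / t - 1 / 2 := by
          rw [sub_nonneg]; gcongr
        rw [ENNReal.coe_mul, ← ENNReal.coe_rpow_of_nonneg _ h0]
        ring

/-- Lower semicontinuity of the `L^p` norm under a.e. convergence transfers the inequality, so `u ∈
L^p` is a conclusion and not an assumption. -/
lemma exists_sobolev_const (hd : 2 ≤ d) (V : ℝ≥0) {p : ℝ} (hp : 2 ≤ p)
    (hpd : 1 / 2 - 1 / (d : ℝ) ≤ 1 / p) :
    ∃ C : ℝ≥0, ∀ U : Set (EuclideanSpace ℝ (Fin d)), MeasurableSet U → volume U = V →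
      ∀ (u : EuclideanSpace ℝ (Fin d) → ℝ)
        (G : EuclideanSpace ℝ (Fin d) → EuclideanSpace ℝ (Fin d)), HasH10Gradient U u G →
      eLpNorm u (ENNReal.ofReal p) (volume.restrict U)
        ≤ C * eLpNorm G 2 (volume.restrict U) := by
  obtain ⟨C, hC⟩ := exists_sobolev_const_of_isTestFunction hd V hp hpd
  refine ⟨C, fun U hU hV u G hu => ?_⟩
  obtain ⟨φ, hφ, h1, h2, h3⟩ := hu.exists_seq_ae
  have l1 := Lp.eLpNorm_lim_le_liminf_eLpNorm (p := ENNReal.ofReal p)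
    (fun n => ((hφ n).memLp 2).1) u h3
  have l2 : Tendsto (fun n => C * (eLpNorm (gradient (φ n) - G) 2 (volume.restrict U)
      + eLpNorm G 2 (volume.restrict U))) atTop (𝓝 (C * eLpNorm G 2 (volume.restrict U))) := by
    simpa using ENNReal.Tendsto.const_mul (h2.add_const (eLpNorm G 2 (volume.restrict U)))
      (Or.inr (ENNReal.coe_ne_top (r := C)))
  rw [← l2.liminf_eq]
  refine l1.trans (liminf_le_liminf (Eventually.of_forall fun n => ?_))
  refine (hC U hU hV (φ n) (hφ n)).trans ?_
  gcongr
  have := eLpNorm_add_le (((hφ n).memLp_gradient 2).sub hu.memLp_grad).1 hu.memLp_grad.1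
    (p := 2) (by norm_num)
  rwa [sub_add_cancel] at this

end Sobolev

/-! ### Smooth truncations -/

section Cutoff

open Real Filter Topology

/-- A smooth bounded nondecreasing function with bounded derivative that vanishes at `0`. -/
structure IsSmoothTruncation (T : ℝ → ℝ) : Prop where
  contDiff : ContDiff ℝ ∞ T
  zero : T 0 = 0
  bounded : ∃ M, ∀ t, ‖T t‖ ≤ M
  deriv_nonneg : ∀ t, 0 ≤ deriv T t
  deriv_bounded : ∃ L, ∀ t, ‖deriv T t‖ ≤ L

namespace IsSmoothTruncation

variable {T : ℝ → ℝ}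

lemma monotone (hT : IsSmoothTruncation T) : Monotone T :=
  monotone_of_deriv_nonneg (hT.contDiff.differentiable (by simp)) hT.deriv_nonneg

lemma mul_nonneg (hT : IsSmoothTruncation T) (t : ℝ) : 0 ≤ t * T t := by
  rcases le_total 0 t with h | h
  · exact _root_.mul_nonneg h (hT.zero ▸ hT.monotone h)
  · exact mul_nonneg_of_nonpos_of_nonpos h (hT.zero ▸ hT.monotone h)

/-- `T` has the sign of its argument, so its primitive from `0` is nonnegative. This primitive
absorbs the drift through `T(u)∇u = ∇S(u)`. -/
lemma exists_primitive (hT : IsSmoothTruncation T) :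
    ∃ S : ℝ → ℝ, ContDiff ℝ ∞ S ∧ S 0 = 0 ∧ (∀ t, 0 ≤ S t) ∧ deriv S = T := by
  have hd : ∀ t, HasDerivAt (fun t => ∫ x in (0 : ℝ)..t, T x) (T t) t := fun t =>
    intervalIntegral.integral_hasDerivAt_right (hT.contDiff.continuous.intervalIntegrable _ _)
      (hT.contDiff.continuous.stronglyMeasurableAtFilter _ _) hT.contDiff.continuous.continuousAt
  have hd' : deriv (fun t => ∫ x in (0 : ℝ)..t, T x) = T := funext fun t => (hd t).deriv
  refine ⟨fun t => ∫ x in (0 : ℝ)..t, T x, ?_, by simp, fun t => ?_, hd'⟩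
  · rw [contDiff_infty_iff_deriv, hd']
    exact ⟨fun t => (hd t).differentiableAt, hT.contDiff⟩
  · rcases le_total 0 t with h | h
    · exact intervalIntegral.integral_nonneg h fun x hx => hT.zero ▸ hT.monotone hx.1
    · change 0 ≤ ∫ x in (0 : ℝ)..t, T x
      rw [intervalIntegral.integral_symm, ← intervalIntegral.integral_neg]
      exact intervalIntegral.integral_nonneg h fun x hx =>
        neg_nonneg.2 (hT.zero ▸ hT.monotone hx.2)

end IsSmoothTruncation

lemma deriv_smoothTransition_nonneg (t : ℝ) : 0 ≤ deriv smoothTransition t :=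
  smoothTransition.monotone.deriv_nonneg

/-- Every `t ≤ 0` is a global minimum point, which includes the endpoint `t = 0`. -/
lemma deriv_smoothTransition_eq_zero {t : ℝ} (ht : t ≤ 0) : deriv smoothTransition t = 0 := by
  refine IsLocalMin.deriv_eq_zero (Eventually.of_forall fun x => ?_)
  rw [smoothTransition.zero_of_nonpos ht]
  exact smoothTransition.nonneg x

lemma exists_deriv_smoothTransition_le : ∃ L : ℝ, 0 < L ∧ ∀ t, deriv smoothTransition t ≤ L := by
  have hc : Continuous (deriv smoothTransition) :=
    (smoothTransition.contDiff (n := 1)).continuous_deriv le_rfl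
  obtain ⟨C, hC⟩ := isCompact_Icc.exists_bound_of_continuousOn (s := Set.Icc (0 : ℝ) 1)
    hc.continuousOn
  refine ⟨max C 1, by positivity, fun t => ?_⟩
  rcases le_total t 0 with h | h
  · rw [deriv_smoothTransition_eq_zero h]; positivity
  rcases le_total t 1 with h' | h'
  · exact ((le_abs_self _).trans (hC t ⟨h, h'⟩)).trans (le_max_left _ _)
  · have : deriv smoothTransition t = 0 := by
      refine IsLocalMax.deriv_eq_zero (Eventually.of_forall fun x => ?_)
      rw [smoothTransition.one_of_one_le h']
      exact smoothTransition.le_one x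
    rw [this]; positivity

/-- A smooth odd function that vanishes on `[-k, k]` and is `±1` outside `[-k - δ, k + δ]`. -/
noncomputable def oddCutoff (k δ t : ℝ) : ℝ :=
  smoothTransition ((t - k) / δ) - smoothTransition ((-t - k) / δ)

variable {k δ : ℝ}

lemma oddCutoff_eq_zero (hδ : 0 < δ) {t : ℝ} (ht : |t| ≤ k) : oddCutoff k δ t = 0 := by
  rw [abs_le] at ht
  rw [oddCutoff, smoothTransition.zero_of_nonpos (div_nonpos_of_nonpos_of_nonneg (by linarith) hδ.le),
    smoothTransition.zero_of_nonpos (div_nonpos_of_nonpos_of_nonneg (by linarith) hδ.le), sub_zero]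

lemma abs_oddCutoff_le_one (t : ℝ) : |oddCutoff k δ t| ≤ 1 := by
  rw [oddCutoff, abs_le]
  have h1 := smoothTransition.nonneg ((t - k) / δ)
  have h2 := smoothTransition.nonneg ((-t - k) / δ)
  have h3 := smoothTransition.le_one ((t - k) / δ)
  have h4 := smoothTransition.le_one ((-t - k) / δ)
  constructor <;> linarith

lemma hasDerivAt_oddCutoff (k δ t : ℝ) : HasDerivAt (oddCutoff k δ)
    ((deriv smoothTransition ((t - k) / δ) + deriv smoothTransition ((-t - k) / δ)) / δ) t := by
  have hs : ∀ x, HasDerivAt smoothTransition (deriv smoothTransition x) x := fun x =>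
    ((smoothTransition.contDiff (n := 1)).differentiable (by simp) x).hasDerivAt
  have h1 : HasDerivAt (fun t : ℝ => (t - k) / δ) (1 / δ) t :=
    ((hasDerivAt_id t).sub_const k).div_const δ
  have h2 : HasDerivAt (fun t : ℝ => (-t - k) / δ) (-1 / δ) t :=
    (((hasDerivAt_id t).neg).sub_const k).div_const δ
  exact (((hs _).comp t h1).sub ((hs _).comp t h2)).congr_deriv (by ring)

lemma deriv_oddCutoff_eq_zero (hδ : 0 < δ) {t : ℝ} (ht : |t| ≤ k) :
    deriv (oddCutoff k δ) t = 0 := by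
  rw [abs_le] at ht
  rw [(hasDerivAt_oddCutoff k δ t).deriv,
    deriv_smoothTransition_eq_zero (div_nonpos_of_nonpos_of_nonneg (by linarith) hδ.le),
    deriv_smoothTransition_eq_zero (div_nonpos_of_nonpos_of_nonneg (by linarith) hδ.le)]
  simp

lemma deriv_oddCutoff_nonneg (hδ : 0 < δ) (t : ℝ) : 0 ≤ deriv (oddCutoff k δ) t := by
  rw [(hasDerivAt_oddCutoff k δ t).deriv]
  exact div_nonneg (add_nonneg (deriv_smoothTransition_nonneg _) (deriv_smoothTransition_nonneg _))
    hδ.le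

lemma abs_oddCutoff_eq_one (hk : 0 ≤ k) (hδ : 0 < δ) {t : ℝ} (ht : k + δ ≤ |t|) :
    |oddCutoff k δ t| = 1 := by
  have key : ∀ t, k + δ ≤ t → oddCutoff k δ t = 1 := fun t ht => by
    rw [oddCutoff, smoothTransition.one_of_one_le ((one_le_div hδ).2 (by linarith)),
      smoothTransition.zero_of_nonpos (div_nonpos_of_nonpos_of_nonneg (by linarith) hδ.le), sub_zero]
  have hodd : oddCutoff k δ (-t) = - oddCutoff k δ t := by simp [oddCutoff]
  rcases le_abs'.1 ht with h | h
  · rw [← abs_neg, ← hodd, key _ (by linarith), abs_one]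
  · rw [key t h, abs_one]

lemma isSmoothTruncation_oddCutoff (hk : 0 ≤ k) (hδ : 0 < δ) :
    IsSmoothTruncation (oddCutoff k δ) := by
  obtain ⟨L, hL0, hL⟩ := exists_deriv_smoothTransition_le
  refine ⟨?_, oddCutoff_eq_zero hδ (by simpa using hk), ⟨1, abs_oddCutoff_le_one⟩,
    deriv_oddCutoff_nonneg hδ, (L + L) / δ, fun t => ?_⟩
  · exact (smoothTransition.contDiff.comp (by fun_prop)).sub
      (smoothTransition.contDiff.comp (by fun_prop))
  · rw [norm_of_nonneg (deriv_oddCutoff_nonneg hδ t), (hasDerivAt_oddCutoff k δ t).deriv]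
    gcongr <;> exact hL _

/-- Here `L` is uniform in `k` and `δ`; the exact scaling `L / δ` drives the iteration over levels.
-/
lemma exists_deriv_oddCutoff_le : ∃ L : ℝ, 0 < L ∧ ∀ k δ t : ℝ, 0 < δ →
    deriv (oddCutoff k δ) t ≤ L / δ := by
  obtain ⟨L, hL0, hL⟩ := exists_deriv_smoothTransition_le
  refine ⟨L + L, by positivity, fun k δ t hδ => ?_⟩
  rw [(hasDerivAt_oddCutoff k δ t).deriv]
  gcongr <;> exact hL _

lemma mul_oddCutoff_eq_abs (hk : 0 ≤ k) (hδ : 0 < δ) {t : ℝ} (ht : k + δ ≤ |t|) :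
    t * oddCutoff k δ t = |t| := by
  rw [← abs_of_nonneg ((isSmoothTruncation_oddCutoff hk hδ).mul_nonneg t), abs_mul,
    abs_oddCutoff_eq_one hk hδ ht, mul_one]

end Cutoff

/-! ### Coefficients and the extended weak formulation -/

section Exponents

variable {d : ℕ} {s : ℝ}

lemma IsLowerSobolevExponent.one_lt (h : IsLowerSobolevExponent d s) : 1 < s := by
  rcases h with ⟨hd, rfl⟩ | ⟨-, h, -⟩
  · have : (3 : ℝ) ≤ d := by exact_mod_cast hd
    rw [one_lt_div (by positivity)]
    linarith
  · exact h

lemma IsLowerSobolevExponent.one_div_conj (h : IsLowerSobolevExponent d s) :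
    1 / s.conjExponent = 1 - 1 / s := by
  have := h.one_lt
  rw [Real.conjExponent]
  field_simp

lemma IsLowerSobolevExponent.two_le_conj (h : IsLowerSobolevExponent d s) :
    2 ≤ s.conjExponent := by
  have h1 := h.one_lt
  have hs2 : s ≤ 2 := by
    rcases h with ⟨hd, rfl⟩ | ⟨-, -, h⟩
    · rw [div_le_iff₀ (by positivity)]; linarith
    · exact h.le
  rw [Real.conjExponent, le_div_iff₀ (by linarith)]
  linarith

/-- For `d ≥ 3` the conjugate of `2_*` is the critical Sobolev exponent `2d/(d-2)` and equality
holds; for `d = 2` the left side is zero and every finite exponent is admissible. -/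
lemma IsLowerSobolevExponent.le_one_div_conj (h : IsLowerSobolevExponent d s) :
    1 / 2 - 1 / (d : ℝ) ≤ 1 / s.conjExponent := by
  have h1 := h.one_lt
  rw [h.one_div_conj]
  rcases h with ⟨hd, rfl⟩ | ⟨rfl, -, -⟩
  · have : (3 : ℝ) ≤ d := by exact_mod_cast hd
    refine le_of_eq ?_
    field_simp
    ring
  · have : 1 / s < 1 := by rw [div_lt_one (by linarith)]; exact h1
    norm_num
    rw [one_div] at this
    exact this.le

lemma ENNReal.holderTriple_ofReal {p q : ℝ} (h : p.HolderConjugate q) :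
    ENNReal.HolderTriple (ENNReal.ofReal p) (ENNReal.ofReal q) 1 := by
  refine ⟨?_⟩
  rw [← ENNReal.ofReal_inv_of_pos h.pos, ← ENNReal.ofReal_inv_of_pos h.symm.pos,
    ← ENNReal.ofReal_add (inv_nonneg.2 h.pos.le) (inv_nonneg.2 h.symm.pos.le),
    h.inv_add_inv_eq_one]
  simp

lemma IsLowerSobolevExponent.holderTriple (h : IsLowerSobolevExponent d s) :
    ENNReal.HolderTriple (ENNReal.ofReal s) (ENNReal.ofReal s.conjExponent) 1 :=
  ENNReal.holderTriple_ofReal (Real.HolderConjugate.conjExponent h.one_lt)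

lemma IsLowerSobolevExponent.one_le_ofReal (h : IsLowerSobolevExponent d s) :
    1 ≤ ENNReal.ofReal s := by
  rw [ENNReal.one_le_ofReal]; exact h.one_lt.le

end Exponents

/-! ### Integrability of the terms of the equation, and testing with truncations of the solution -/

section Coefficients

open Filter Topology

variable {d : ℕ} {U : Set (EuclideanSpace ℝ (Fin d))}
  {A : EuclideanSpace ℝ (Fin d) → Matrix (Fin d) (Fin d) ℝ}
  {B : EuclideanSpace ℝ (Fin d) → EuclideanSpace ℝ (Fin d)}
  {c f u v w : EuclideanSpace ℝ (Fin d) → ℝ} {s lam α : ℝ}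
  {F G G' : EuclideanSpace ℝ (Fin d) → EuclideanSpace ℝ (Fin d)}

lemma CoefficientAssumptions.isFiniteMeasure (h : CoefficientAssumptions s lam U A B c) :
    IsFiniteMeasure (volume.restrict U) :=
  ⟨by simpa using h.isBounded.measure_lt_top⟩

lemma norm_toEuclideanLin_le {M : Matrix (Fin d) (Fin d) ℝ} {L : ℝ} (hM : ∀ i j, |M i j| ≤ L)
    (ξ : EuclideanSpace ℝ (Fin d)) : ‖M.toEuclideanLin ξ‖ ≤ d * (d * L) * ‖ξ‖ := by
  have h1 : ∀ i, ‖(M.toEuclideanLin ξ) i‖ ≤ d * L * ‖ξ‖ := fun i => by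
    have e : (M.toEuclideanLin ξ) i = ∑ j, M i j * ξ j := by
      simp [Matrix.toLpLin_apply, Matrix.mulVec, dotProduct]
    rw [e]
    calc ‖∑ j, M i j * ξ j‖ ≤ ∑ j, ‖M i j * ξ j‖ := norm_sum_le _ _
      _ ≤ ∑ _j : Fin d, L * ‖ξ‖ := by
          refine Finset.sum_le_sum fun j _ => ?_
          rw [norm_mul]
          exact mul_le_mul (hM i j) (PiLp.norm_apply_le ξ j) (norm_nonneg _)
            ((abs_nonneg _).trans (hM i j))
      _ = d * L * ‖ξ‖ := by simp; ring
  have h0 : 0 ≤ ∑ i, ‖(M.toEuclideanLin ξ) i‖ := Finset.sum_nonneg fun _ _ => norm_nonneg _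
  calc ‖M.toEuclideanLin ξ‖ ≤ ∑ i, ‖(M.toEuclideanLin ξ) i‖ := by
        rw [EuclideanSpace.norm_eq]
        exact Real.sqrt_le_iff.2 ⟨h0, Finset.sum_sq_le_sq_sum_of_nonneg fun _ _ => norm_nonneg _⟩
    _ ≤ ∑ _i : Fin d, d * L * ‖ξ‖ := Finset.sum_le_sum fun i _ => h1 i
    _ = _ := by simp; ring

namespace CoefficientAssumptions

lemma exists_norm_le (h : CoefficientAssumptions s lam U A B c) :
    ∃ L : ℝ, ∀ x ∈ U, ∀ ξ : EuclideanSpace ℝ (Fin d), ‖(A x).toEuclideanLin ξ‖ ≤ L * ‖ξ‖ := by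
  obtain ⟨L, -, hL⟩ := h.bounded_A
  exact ⟨d * (d * L), fun x hx ξ => norm_toEuclideanLin_le (hL x hx) ξ⟩

lemma aestronglyMeasurable_mul (h : CoefficientAssumptions s lam U A B c)
    (hG : AEStronglyMeasurable G (volume.restrict U)) :
    AEStronglyMeasurable (fun x => (A x).toEuclideanLin (G x)) (volume.restrict U) := by
  have e : (fun x => (A x).toEuclideanLin (G x))
      = fun x => WithLp.toLp 2 (fun i => ∑ j, A x i j * G x j) := by
    ext x i
    simp [Matrix.toLpLin_apply, Matrix.mulVec, dotProduct]
  rw [e]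
  refine (PiLp.continuous_toLp 2 _).comp_aestronglyMeasurable
    (aemeasurable_pi_iff.2 fun i => ?_).aestronglyMeasurable
  refine Finset.aemeasurable_fun_sum _ fun j _ => ?_
  exact (h.memLp_A i j).1.aemeasurable.mul
    ((EuclideanSpace.proj j : EuclideanSpace ℝ (Fin d) →L[ℝ] ℝ).continuous.comp_aestronglyMeasurable
      hG).aemeasurable

lemma memLp_mul (h : CoefficientAssumptions s lam U A B c) {p : ℝ≥0∞}
    (hG : MemLp G p (volume.restrict U)) :
    MemLp (fun x => (A x).toEuclideanLin (G x)) p (volume.restrict U) := by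
  obtain ⟨L, hL⟩ := h.exists_norm_le
  refine hG.of_le_mul (c := L) (h.aestronglyMeasurable_mul hG.1) ?_
  exact ae_restrict_of_forall_mem h.isOpen.measurableSet fun x hx => hL x hx _

end CoefficientAssumptions

/-- The exponent `2_*` is made for this: `u` lies in the dual space of `L^{2_*}`, so `c u` is
integrable. -/
lemma HasH10Gradient.memLp_conj (hu : HasH10Gradient U u G) (hd : 2 ≤ d)
    (hs : IsLowerSobolevExponent d s) (hU : MeasurableSet U)
    [IsFiniteMeasure (volume.restrict U)] :
    MemLp u (ENNReal.ofReal s.conjExponent) (volume.restrict U) := by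
  have hfin : volume U ≠ ⊤ := by
    have := measure_ne_top (volume.restrict U) Set.univ
    rwa [Measure.restrict_apply_univ] at this
  obtain ⟨C, hC⟩ := exists_sobolev_const hd (volume U).toNNReal hs.two_le_conj hs.le_one_div_conj
  exact ⟨hu.memLp.1, (hC U hU (ENNReal.coe_toNNReal hfin).symm u G hu).trans_lt
    (ENNReal.mul_lt_top ENNReal.coe_lt_top hu.memLp_grad.2)⟩

namespace CoefficientAssumptions

lemma integrable_potential_mul (h : CoefficientAssumptions s lam U A B c)
    (hs : IsLowerSobolevExponent d s) (hu : MemLp u 2 (volume.restrict U))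
    (hu' : MemLp u (ENNReal.ofReal s.conjExponent) (volume.restrict U)) :
    Integrable (fun x => (c x + α) * u x) (volume.restrict U) := by
  have := h.isFiniteMeasure
  have := hs.holderTriple
  have h1 : Integrable (fun x => c x * u x) (volume.restrict U) := h.memLp_c.integrable_mul hu'
  have h2 : Integrable (fun x => α * u x) (volume.restrict U) :=
    (hu.integrable (by norm_num)).const_mul α
  exact (h1.add h2).congr (ae_of_all _ fun x => (add_mul _ _ _).symm)

lemma integrable_lower (h : CoefficientAssumptions s lam U A B c) (hd : 2 ≤ d)
    (hs : IsLowerSobolevExponent d s) (hu : HasH10Gradient U u G) (α : ℝ) :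
    Integrable (fun x => inner ℝ (B x) (G x) + (c x + α) * u x) (volume.restrict U) := by
  have := h.isFiniteMeasure
  exact (h.memLp_B.integrable_real_inner hu.memLp_grad).add (h.integrable_potential_mul hs hu.memLp
    (hu.memLp_conj hd hs h.isOpen.measurableSet))

end CoefficientAssumptions

lemma MeasureTheory.Integrable.mul_of_bounded {β : Type*} [MeasurableSpace β] {μ : Measure β} {g ψ : β → ℝ}
    (hg : Integrable g μ) (hψ : AEStronglyMeasurable ψ μ) {M : ℝ} (hM : ∀ x, ‖ψ x‖ ≤ M) :
    Integrable (fun x => g x * ψ x) μ :=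
  hg.mul_bdd hψ (ae_of_all _ hM)

lemma tendsto_integral_mul_of_bounded {β : Type*} [MeasurableSpace β] {μ : Measure β}
    {g ψ₀ : β → ℝ} {ψ : ℕ → β → ℝ}
    (hg : Integrable g μ) (hψ : ∀ n, AEStronglyMeasurable (ψ n) μ) {M : ℝ}
    (hM : ∀ n x, ‖ψ n x‖ ≤ M) (hlim : ∀ᵐ x ∂μ, Tendsto (fun n => ψ n x) atTop (𝓝 (ψ₀ x))) :
    Tendsto (fun n => ∫ x, g x * ψ n x ∂μ) atTop (𝓝 (∫ x, g x * ψ₀ x ∂μ)) := by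
  refine tendsto_integral_of_dominated_convergence (fun x => ‖g x‖ * M)
    (fun n => hg.1.mul (hψ n)) (hg.norm.mul_const M) (fun n => ae_of_all _ fun x => ?_) ?_
  · rw [norm_mul]; gcongr; exact hM n x
  · filter_upwards [hlim] with x hx
    exact hx.const_mul _

/-- `(u, G)` satisfies the weak formulation of
`-div(A∇u) + ⟨B,∇u⟩ + (c+α)u = f - div F` on `U`, with `G` in place of `∇u`. -/
def WeakFormulation (U : Set (EuclideanSpace ℝ (Fin d)))
    (A : EuclideanSpace ℝ (Fin d) → Matrix (Fin d) (Fin d) ℝ)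
    (B : EuclideanSpace ℝ (Fin d) → EuclideanSpace ℝ (Fin d))
    (c : EuclideanSpace ℝ (Fin d) → ℝ) (α : ℝ) (f : EuclideanSpace ℝ (Fin d) → ℝ)
    (F : EuclideanSpace ℝ (Fin d) → EuclideanSpace ℝ (Fin d))
    (u : EuclideanSpace ℝ (Fin d) → ℝ)
    (G : EuclideanSpace ℝ (Fin d) → EuclideanSpace ℝ (Fin d)) : Prop :=
  ∀ φ : EuclideanSpace ℝ (Fin d) → ℝ, IsTestFunction U φ →
    ∫ x in U, (inner ℝ ((A x).toEuclideanLin (G x)) (gradient φ x)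
      + (inner ℝ (B x) (G x) + (c x + α) * u x) * φ x)
      = ∫ x in U, (f x * φ x + inner ℝ (F x) (gradient φ x))

lemma IsTestFunction.integrable_mul {φ : EuclideanSpace ℝ (Fin d) → ℝ} (hφ : IsTestFunction U φ)
    {g : EuclideanSpace ℝ (Fin d) → ℝ} (hg : Integrable g (volume.restrict U)) :
    Integrable (fun x => g x * φ x) (volume.restrict U) := by
  obtain ⟨M, hM⟩ := hφ.exists_bound
  exact hg.mul_of_bounded hφ.continuous.aestronglyMeasurable hM

lemma IsTestFunction.integrable_inner {φ : EuclideanSpace ℝ (Fin d) → ℝ}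
    (hφ : IsTestFunction U φ) (hF : MemLp F 2 (volume.restrict U)) :
    Integrable (fun x => inner ℝ (F x) (gradient φ x)) (volume.restrict U) :=
  hF.integrable_real_inner (hφ.memLp_gradient 2)

/-- The weak formulation may be tested with smooth bounded functions of the solution. -/
lemma WeakFormulation.comp (hw : WeakFormulation U A B c α f F u G)
    (h : CoefficientAssumptions s lam U A B c) (hd : 2 ≤ d) (hs : IsLowerSobolevExponent d s)
    (hu : HasH10Gradient U u G) (hf : Integrable f (volume.restrict U))
    (hF : MemLp F 2 (volume.restrict U)) {T : ℝ → ℝ} (hT : IsSmoothTruncation T) :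
    (∫ x in U, inner ℝ (deriv T (u x) • G x) ((A x).toEuclideanLin (G x)))
      + ∫ x in U, (inner ℝ (B x) (G x) + (c x + α) * u x) * T (u x)
      = (∫ x in U, f x * T (u x)) + ∫ x in U, inner ℝ (deriv T (u x) • G x) (F x) := by
  obtain ⟨L, hL⟩ := hT.deriv_bounded
  obtain ⟨M, hM⟩ := hT.bounded
  obtain ⟨φ, -, hφ, -, h2, h3⟩ := hu.exists_seq_comp hT.contDiff hT.zero hL
  have hAG := h.memLp_mul hu.memLp_grad
  have hlow := h.integrable_lower hd hs hu α
  have hTu := hu.comp hT.contDiff hT.zero hL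
  -- The terms containing `∇T(φₙ)` converge by `L²` convergence. The other two have a factor that is
  -- only integrable, and converge because `T(φₙ)` is uniformly bounded and converges a.e.
  have t1 := tendsto_integral_inner (fun n => (hφ n).memLp_gradient 2) hTu.memLp_grad hAG h2
  have t2 := tendsto_integral_mul_of_bounded hlow
    (fun n => (hφ n).continuous.aestronglyMeasurable) (fun n x => hM (φ n x)) h3
  have t3 := tendsto_integral_mul_of_bounded hf
    (fun n => (hφ n).continuous.aestronglyMeasurable) (fun n x => hM (φ n x)) h3
  have t4 := tendsto_integral_inner (fun n => (hφ n).memLp_gradient 2) hTu.memLp_grad hF h2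
  refine tendsto_nhds_unique (t1.add t2) ((t3.add t4).congr fun n => ?_)
  have e1 := integral_add ((hφ n).integrable_inner hAG) ((hφ n).integrable_mul hlow)
  have e2 := integral_add ((hφ n).integrable_mul hf) ((hφ n).integrable_inner hF)
  simp only [real_inner_comm _ (gradient _ _)] at e1 e2 ⊢
  rw [← e1, ← e2]
  have := (hw _ (hφ n)).symm
  simpa only [real_inner_comm _ (gradient _ _)] using this

/-- The drift contributes a nonnegative term when tested with a truncation of the solution. -/
lemma CoefficientAssumptions.drift_nonneg (h : CoefficientAssumptions s lam U A B c)
    (hu : HasH10Gradient U u G) {T : ℝ → ℝ} (hT : IsSmoothTruncation T) :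
    0 ≤ ∫ x in U, inner ℝ (B x) (G x) * T (u x) := by
  obtain ⟨M, hM⟩ := hT.bounded
  -- Now `T` is `deriv S`, the integrand is `⟨B, ∇S(u)⟩`, and each `S ∘ φₙ` is a nonnegative test
  -- function, so the sign condition on `div B` survives in the limit.
  obtain ⟨S, hS, hS0, hSn, rfl⟩ := hT.exists_primitive
  obtain ⟨φ, -, hφ, -, h2, -⟩ := hu.exists_seq_comp hS hS0 hM
  have t := tendsto_integral_inner (fun n => (hφ n).memLp_gradient 2)
    (hu.comp hS hS0 hM).memLp_grad h.memLp_B h2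
  have h0 := ge_of_tendsto' t fun n => by
    simpa only [real_inner_comm] using h.div_B_nonpos _ (hφ n) fun x => hSn _
  refine h0.trans (le_of_eq (integral_congr_ae (ae_of_all _ fun x => ?_)))
  beta_reduce
  rw [real_inner_smul_left, real_inner_comm, mul_comm]

/-- The basic energy inequality for truncations. -/
lemma WeakFormulation.energy (hw : WeakFormulation U A B c α f F u G)
    (h : CoefficientAssumptions s lam U A B c) (hd : 2 ≤ d) (hs : IsLowerSobolevExponent d s)
    (hu : HasH10Gradient U u G) (hf : Integrable f (volume.restrict U))
    (hF : MemLp F 2 (volume.restrict U)) {T : ℝ → ℝ} (hT : IsSmoothTruncation T) :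
    lam * (∫ x in U, deriv T (u x) * ‖G x‖ ^ 2) + α * (∫ x in U, u x * T (u x))
      ≤ (∫ x in U, f x * T (u x)) + ∫ x in U, deriv T (u x) * (‖F x‖ * ‖G x‖) := by
  have := h.isFiniteMeasure
  obtain ⟨L, hL⟩ := hT.deriv_bounded
  obtain ⟨M, hM⟩ := hT.bounded
  have hTu := hu.comp hT.contDiff hT.zero hL
  have mT : AEStronglyMeasurable (fun x => T (u x)) (volume.restrict U) := hTu.memLp.1
  have mdT : AEStronglyMeasurable (fun x => deriv T (u x)) (volume.restrict U) :=
    (hT.contDiff.continuous_deriv (by simp)).comp_aestronglyMeasurable hu.memLp.1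
  have hAG := h.memLp_mul hu.memLp_grad
  have iB : Integrable (fun x => inner ℝ (B x) (G x) * T (u x)) (volume.restrict U) :=
    (h.memLp_B.integrable_real_inner hu.memLp_grad).mul_of_bounded mT fun x => hM _
  have iu : Integrable (fun x => u x * T (u x)) (volume.restrict U) :=
    (hu.memLp.integrable (by norm_num)).mul_of_bounded mT fun x => hM _
  have ic : Integrable (fun x => (c x + α) * u x * T (u x)) (volume.restrict U) :=
    (h.integrable_potential_mul hs hu.memLp
      (hu.memLp_conj hd hs h.isOpen.measurableSet)).mul_of_bounded mT fun x => hM _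
  have iG : Integrable (fun x => deriv T (u x) * ‖G x‖ ^ 2) (volume.restrict U) := by
    refine (hTu.memLp_grad.integrable_real_inner hu.memLp_grad).congr (ae_of_all _ fun x => ?_)
    simp [real_inner_smul_left]
  have iFG : Integrable (fun x => deriv T (u x) * (‖F x‖ * ‖G x‖)) (volume.restrict U) := by
    refine ((hF.norm.integrable_mul hu.memLp_grad.norm).mul_of_bounded mdT
      fun x => hL _).congr (ae_of_all _ fun x => ?_)
    simp [mul_comm]
  have key := hw.comp h hd hs hu hf hF hT
  have hB := h.drift_nonneg hu hT
  have e1 : ∫ x in U, (inner ℝ (B x) (G x) + (c x + α) * u x) * T (u x)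
      = (∫ x in U, inner ℝ (B x) (G x) * T (u x)) + ∫ x in U, (c x + α) * u x * T (u x) := by
    rw [← integral_add iB ic]; simp only [add_mul]
  have l1 : lam * (∫ x in U, deriv T (u x) * ‖G x‖ ^ 2)
      ≤ ∫ x in U, inner ℝ (deriv T (u x) • G x) ((A x).toEuclideanLin (G x)) := by
    rw [← integral_const_mul]
    refine integral_mono_ae (iG.const_mul lam) (hTu.memLp_grad.integrable_real_inner hAG) ?_
    refine ae_restrict_of_forall_mem h.isOpen.measurableSet fun x hx => ?_
    have := mul_le_mul_of_nonneg_left (h.elliptic x hx (G x)) (hT.deriv_nonneg (u x))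
    rw [real_inner_comm] at this
    simp only [real_inner_smul_left]
    linarith
  have l2 : α * (∫ x in U, u x * T (u x)) ≤ ∫ x in U, (c x + α) * u x * T (u x) := by
    rw [← integral_const_mul]
    refine integral_mono_ae (iu.const_mul α) ic ?_
    filter_upwards [h.c_nonneg] with x hx
    have := mul_nonneg hx (hT.mul_nonneg (u x))
    linarith
  have l3 : ∫ x in U, inner ℝ (deriv T (u x) • G x) (F x)
      ≤ ∫ x in U, deriv T (u x) * (‖F x‖ * ‖G x‖) := by
    refine integral_mono_ae (hTu.memLp_grad.integrable_real_inner hF) iFG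
      (ae_of_all _ fun x => ?_)
    simp only [real_inner_smul_left]
    refine mul_le_mul_of_nonneg_left ?_ (hT.deriv_nonneg _)
    rw [mul_comm]
    exact real_inner_le_norm _ _
  rw [e1] at key
  linarith

end Coefficients

/-! ### Stampacchia's iteration and the `L^∞` bound -/

section Stampacchia

open Filter Topology

/-- Stampacchia's lemma: a nonincreasing function with superlinear decay between levels vanishes
at a level that is controlled by the data. -/
lemma exists_level_of_superlinear_decay {a b D V : ℝ} (ha : 0 < a) (hab : a < b) (hD : 0 ≤ D)
    (hV : 0 ≤ V) :
    ∃ M : ℝ, 1 ≤ M ∧ ∀ (y : ℝ → ℝ) (K : ℝ), Antitone y → (∀ t, 0 ≤ y t) → y 0 ≤ V → 0 < K →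
      (∀ k δ, 0 ≤ k → 0 < δ → y (k + δ) ^ a ≤ D * (K / δ + K ^ 2 / δ ^ 2) * y k ^ b) →
      y (M * K) = 0 := by
  -- Adding `1` keeps `Z` positive when `V = 0`, so that it can be raised to real powers freely.
  set Z : ℝ := V + 1 with hZdef
  have hZ : 0 < Z := by positivity
  have hba : 0 < b - a := sub_pos.2 hab
  -- The ratio `r` is chosen so that `r^{b-a} = 1/4` cancels the factor `4^n` produced by halving
  -- the gaps between levels; `M` then has to absorb `8 D Z^{b-a} / r^a`.
  set r : ℝ := (1 / 4 : ℝ) ^ (1 / (b - a)) with hr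
  have hr0 : 0 < r := by positivity
  have hr1 : r < 1 := Real.rpow_lt_one (by norm_num) (by norm_num) (by positivity)
  have hrba : r ^ (b - a) = 1 / 4 := by
    rw [hr, ← Real.rpow_mul (by norm_num), one_div_mul_cancel hba.ne', Real.rpow_one]
  set M : ℝ := max 1 (8 * D * Z ^ (b - a) / r ^ a) with hM
  have hM1 : 1 ≤ M := le_max_left _ _
  have hM0 : 0 < M := by linarith
  have hMD : 8 * D * Z ^ (b - a) ≤ M * r ^ a := by
    rw [← div_le_iff₀ (by positivity)]; exact le_max_right _ _
  refine ⟨M, hM1, fun y K hy hy0 hyV hK hdec => ?_⟩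
  -- Along the levels `MK(1 - 2⁻ⁿ)`, which increase to `MK`, the function decays geometrically.
  have key : ∀ n : ℕ, y (M * K * (1 - (1 / 2) ^ n)) ≤ Z * r ^ n := by
    intro n
    induction n with
    | zero => simp; linarith
    | succ n ih =>
      set k : ℝ := M * K * (1 - (1 / 2) ^ n) with hk
      set δ : ℝ := M * K * (1 / 2) ^ (n + 1) with hδ
      have hk0 : 0 ≤ k := by
        have : (1 / 2 : ℝ) ^ n ≤ 1 := pow_le_one₀ (by norm_num) (by norm_num)
        have : 0 ≤ 1 - (1 / 2 : ℝ) ^ n := by linarith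
        positivity
      have hδ0 : 0 < δ := by positivity
      have hkδ : M * K * (1 - (1 / 2) ^ (n + 1)) = k + δ := by rw [hk, hδ]; ring
      rw [hkδ]
      have hKδ : K / δ = 2 ^ (n + 1) / M := by
        rw [hδ, one_div, inv_pow]; field_simp
      -- Each summand is at most `4^{n+1} / M`; for the quadratic one this uses `M ≥ 1`.
      have hcoef : K / δ + K ^ 2 / δ ^ 2 ≤ 8 * 4 ^ n / M := by
        rw [← div_pow, hKδ]
        have e1 : (2 : ℝ) ^ (n + 1) ≤ 4 ^ (n + 1) := by gcongr; norm_num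
        have e2 : ((2 : ℝ) ^ (n + 1) / M) ^ 2 ≤ 4 ^ (n + 1) / M := by
          rw [div_pow, ← pow_mul, mul_comm (n + 1), pow_mul]
          norm_num
          gcongr
          nlinarith
        have e3 : (2 : ℝ) ^ (n + 1) / M ≤ 4 ^ (n + 1) / M := by gcongr
        calc _ ≤ (4 : ℝ) ^ (n + 1) / M + 4 ^ (n + 1) / M := add_le_add e3 e2
          _ = _ := by ring
      have h4 : (4 : ℝ) ^ n * (r ^ n) ^ b = (r ^ n) ^ a := by
        have : (r ^ n) ^ b = (r ^ n) ^ a * (r ^ n) ^ (b - a) := by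
          rw [← Real.rpow_add (by positivity)]; congr 1; ring
        have e : (r ^ n) ^ (b - a) = (1 / 4) ^ n := by
          rw [← hrba, ← Real.rpow_natCast, ← Real.rpow_natCast, ← Real.rpow_mul hr0.le,
            ← Real.rpow_mul hr0.le, mul_comm]
        rw [this, e, mul_left_comm, ← mul_pow]
        norm_num
      have hfin : y (k + δ) ^ a ≤ (Z * r ^ (n + 1)) ^ a := by
        calc y (k + δ) ^ a ≤ D * (K / δ + K ^ 2 / δ ^ 2) * y k ^ b := hdec k δ hk0 hδ0
          _ ≤ D * (8 * 4 ^ n / M) * (Z * r ^ n) ^ b := by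
              exact mul_le_mul (by gcongr) (Real.rpow_le_rpow (hy0 k) ih (ha.trans hab).le)
                (Real.rpow_nonneg (hy0 k) _) (by positivity)
          _ = (8 * D * Z ^ (b - a)) * Z ^ a * (4 ^ n * (r ^ n) ^ b) / M := by
              rw [Real.mul_rpow hZ.le (by positivity)]
              have : Z ^ b = Z ^ (b - a) * Z ^ a := by
                rw [← Real.rpow_add hZ]; congr 1; ring
              rw [this]; ring
          _ ≤ (M * r ^ a) * Z ^ a * (4 ^ n * (r ^ n) ^ b) / M := by gcongr
          _ = (Z * r ^ (n + 1)) ^ a := by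
              rw [h4, Real.mul_rpow hZ.le (by positivity), pow_succ,
                Real.mul_rpow (by positivity) hr0.le]
              field_simp
      exact (Real.rpow_le_rpow_iff (hy0 _) (by positivity) ha).1 hfin
  refine le_antisymm ?_ (hy0 _)
  have hlim : Tendsto (fun n : ℕ => Z * r ^ n) atTop (𝓝 0) := by
    simpa using (tendsto_pow_atTop_nhds_zero_of_lt_one hr0.le hr1).const_mul Z
  refine ge_of_tendsto' hlim fun n => (hy ?_).trans (key n)
  have : 0 ≤ (1 / 2 : ℝ) ^ n := by positivity
  have := mul_nonneg (mul_nonneg hM0.le hK.le) this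
  linarith

variable {d : ℕ} {U : Set (EuclideanSpace ℝ (Fin d))}
  {A : EuclideanSpace ℝ (Fin d) → Matrix (Fin d) (Fin d) ℝ}
  {B : EuclideanSpace ℝ (Fin d) → EuclideanSpace ℝ (Fin d)}
  {c f u : EuclideanSpace ℝ (Fin d) → ℝ} {s lam α : ℝ}
  {F G : EuclideanSpace ℝ (Fin d) → EuclideanSpace ℝ (Fin d)}

/-- Energy of a truncation in terms of the data on a superlevel set. -/
lemma WeakFormulation.energy_oddCutoff (hw : WeakFormulation U A B c α f F u G)
    (h : CoefficientAssumptions s lam U A B c) (hlam : 0 < lam) (hα : 0 ≤ α) (hd : 2 ≤ d)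
    (hs : IsLowerSobolevExponent d s)
    (hu : HasH10Gradient U u G) (hf : Integrable f (volume.restrict U))
    (hF : MemLp F 2 (volume.restrict U)) {k δ L : ℝ} (hk : 0 ≤ k) (hδ : 0 < δ)
    (hL : ∀ t, deriv (oddCutoff k δ) t ≤ L / δ) {S : Set (EuclideanSpace ℝ (Fin d))}
    (hS : MeasurableSet S) (hSk : ∀ᵐ x ∂volume.restrict U, k < |u x| → x ∈ S) :
    (lam / 2) * (∫ x in U, deriv (oddCutoff k δ) (u x) * ‖G x‖ ^ 2)
      ≤ (∫ x in S, |f x| ∂volume.restrict U)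
        + (1 / (2 * lam)) * (L / δ) * ∫ x in S, ‖F x‖ ^ 2 ∂volume.restrict U := by
  have := h.isFiniteMeasure
  have hT := isSmoothTruncation_oddCutoff hk hδ
  obtain ⟨L', hL'⟩ := hT.deriv_bounded
  have en := hw.energy h hd hs hu hf hF hT
  have mdT : AEStronglyMeasurable (fun x => deriv (oddCutoff k δ) (u x)) (volume.restrict U) :=
    (hT.contDiff.continuous_deriv (by simp)).comp_aestronglyMeasurable hu.memLp.1
  have mT : AEStronglyMeasurable (fun x => oddCutoff k δ (u x)) (volume.restrict U) :=
    hT.contDiff.continuous.comp_aestronglyMeasurable hu.memLp.1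
  have iG2 : Integrable (fun x => ‖G x‖ ^ 2) (volume.restrict U) :=
    hu.memLp_grad.norm.integrable_sq
  have iF2 : Integrable (fun x => ‖F x‖ ^ 2) (volume.restrict U) := hF.norm.integrable_sq
  have iG : Integrable (fun x => deriv (oddCutoff k δ) (u x) * ‖G x‖ ^ 2) (volume.restrict U) := by
    simpa only [mul_comm] using iG2.mul_of_bounded mdT fun x => hL' _
  have iF : Integrable (fun x => deriv (oddCutoff k δ) (u x) * ‖F x‖ ^ 2) (volume.restrict U) := by
    simpa only [mul_comm] using iF2.mul_of_bounded mdT fun x => hL' _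
  have iFG : Integrable (fun x => deriv (oddCutoff k δ) (u x) * (‖F x‖ * ‖G x‖))
      (volume.restrict U) := by
    refine ((hF.norm.integrable_mul hu.memLp_grad.norm).mul_of_bounded mdT
      fun x => hL' _).congr (ae_of_all _ fun x => ?_)
    simp [mul_comm]
  have hαT : 0 ≤ α * ∫ x in U, u x * oddCutoff k δ (u x) :=
    mul_nonneg hα (integral_nonneg fun x => hT.mul_nonneg _)
  -- Young's inequality with the weight `T'(u)` kept on both sides: half of the elliptic term
  -- absorbs the part containing `G`.
  have y1 : ∫ x in U, deriv (oddCutoff k δ) (u x) * (‖F x‖ * ‖G x‖)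
      ≤ (lam / 2) * (∫ x in U, deriv (oddCutoff k δ) (u x) * ‖G x‖ ^ 2)
        + (1 / (2 * lam)) * ∫ x in U, deriv (oddCutoff k δ) (u x) * ‖F x‖ ^ 2 := by
    rw [← integral_const_mul, ← integral_const_mul,
      ← integral_add (iG.const_mul _) (iF.const_mul _)]
    refine integral_mono iFG ((iG.const_mul _).add (iF.const_mul _)) fun x => ?_
    have e : ‖F x‖ * ‖G x‖ ≤ lam / 2 * ‖G x‖ ^ 2 + 1 / (2 * lam) * ‖F x‖ ^ 2 := by
      have := sq_nonneg (lam * ‖G x‖ - ‖F x‖)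
      rw [← mul_le_mul_iff_right₀ (show 0 < 2 * lam by positivity)]
      have e2 : 2 * lam * (lam / 2 * ‖G x‖ ^ 2 + 1 / (2 * lam) * ‖F x‖ ^ 2)
          = lam ^ 2 * ‖G x‖ ^ 2 + ‖F x‖ ^ 2 := by field_simp
      rw [e2]; nlinarith
    have := mul_le_mul_of_nonneg_left e (hT.deriv_nonneg (u x))
    linarith
  have y2 : ∫ x in U, f x * oddCutoff k δ (u x) ≤ ∫ x in S, |f x| ∂volume.restrict U := by
    rw [← integral_indicator hS]
    refine integral_mono_ae (hf.mul_of_bounded mT fun x => abs_oddCutoff_le_one _)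
      (hf.abs.indicator hS) ?_
    filter_upwards [hSk] with x hx
    by_cases hxk : k < |u x|
    · rw [Set.indicator_of_mem (hx hxk)]
      refine (le_abs_self _).trans ?_
      rw [abs_mul]
      exact mul_le_of_le_one_right (abs_nonneg _) (abs_oddCutoff_le_one _)
    · rw [oddCutoff_eq_zero hδ (not_lt.1 hxk), mul_zero]
      exact Set.indicator_nonneg (fun _ _ => abs_nonneg _) _
  have y3 : ∫ x in U, deriv (oddCutoff k δ) (u x) * ‖F x‖ ^ 2
      ≤ (L / δ) * ∫ x in S, ‖F x‖ ^ 2 ∂volume.restrict U := by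
    rw [← integral_indicator hS, ← integral_const_mul]
    refine integral_mono_ae iF ((iF2.indicator hS).const_mul _) ?_
    filter_upwards [hSk] with x hx
    by_cases hxk : k < |u x|
    · rw [Set.indicator_of_mem (hx hxk)]
      exact mul_le_mul_of_nonneg_right (hL _) (sq_nonneg _)
    · rw [deriv_oddCutoff_eq_zero hδ (not_lt.1 hxk), zero_mul]
      exact mul_nonneg ((hT.deriv_nonneg 0).trans (hL 0))
        (Set.indicator_nonneg (fun _ _ => sq_nonneg _) _)
  have y4 := mul_le_mul_of_nonneg_left y3 (show 0 ≤ 1 / (2 * lam) by positivity)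
  linarith

lemma setIntegral_norm_le_rpow {X E : Type*} [MeasurableSpace X] {μ : Measure X}
    [IsFiniteMeasure μ]
    [NormedAddCommGroup E] {g : X → E} {q : ℝ} (hq : 1 < q) (hg : MemLp g (ENNReal.ofReal q) μ)
    (S : Set X) :
    ∫ x in S, ‖g x‖ ∂μ
      ≤ (eLpNorm g (ENNReal.ofReal q) μ).toReal * (μ S).toReal ^ (1 - 1 / q) := by
  have h1 := eLpNorm_le_eLpNorm_mul_rpow_measure_univ (p := 1) (q := ENNReal.ofReal q)
    (μ := μ.restrict S) (by rw [ENNReal.one_le_ofReal]; exact hq.le) (hg.1.restrict)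
  have h2 : eLpNorm g (ENNReal.ofReal q) (μ.restrict S) ≤ eLpNorm g (ENNReal.ofReal q) μ :=
    eLpNorm_mono_measure _ Measure.restrict_le_self
  rw [Measure.restrict_apply_univ, ENNReal.toReal_one, ENNReal.toReal_ofReal (by linarith),
    div_one, eLpNorm_one_eq_lintegral_enorm] at h1
  have hfin : (μ S) ^ (1 - 1 / q) ≠ ⊤ := by
    refine ENNReal.rpow_ne_top_of_nonneg ?_ (measure_ne_top _ _)
    rw [sub_nonneg, div_le_one (by linarith)]; exact hq.le
  rw [integral_norm_eq_lintegral_enorm hg.1.restrict, ENNReal.toReal_rpow, ← ENNReal.toReal_mul]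
  exact ENNReal.toReal_mono (ENNReal.mul_ne_top hg.2.ne hfin) (h1.trans (by gcongr))

lemma eLpNorm_norm_sq_toReal {X E : Type*} [MeasurableSpace X] {μ : Measure X}
    [NormedAddCommGroup E] (g : X → E) {q : ℝ} (hq : 0 < q) :
    (eLpNorm (fun x => ‖g x‖ ^ 2) (ENNReal.ofReal q) μ).toReal
      = (eLpNorm g (ENNReal.ofReal (2 * q)) μ).toReal ^ 2 := by
  have := eLpNorm_norm_rpow (p := ENNReal.ofReal q) (μ := μ) g (q := 2) (by norm_num)
  rw [← ENNReal.ofReal_mul hq.le, mul_comm q 2] at this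
  simp only [Real.rpow_two] at this
  rw [this]
  norm_cast
  rw [ENNReal.toReal_pow]

/-- Decay of the measure of superlevel sets of a weak solution. -/
lemma WeakFormulation.exists_decay (hd : 2 ≤ d) (hlam : 0 < lam) (V : ℝ≥0) {p q : ℝ} (hp : 2 ≤ p)
    (hpd : 1 / 2 - 1 / (d : ℝ) ≤ 1 / p) (hq : 1 < q) :
    ∃ D : ℝ, 0 ≤ D ∧ ∀ (U : Set (EuclideanSpace ℝ (Fin d)))
      (A : EuclideanSpace ℝ (Fin d) → Matrix (Fin d) (Fin d) ℝ)
      (B : EuclideanSpace ℝ (Fin d) → EuclideanSpace ℝ (Fin d))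
      (c : EuclideanSpace ℝ (Fin d) → ℝ) (α s K : ℝ) (f u : EuclideanSpace ℝ (Fin d) → ℝ)
      (F G : EuclideanSpace ℝ (Fin d) → EuclideanSpace ℝ (Fin d)),
      volume U = V → CoefficientAssumptions s lam U A B c → 0 ≤ α → IsLowerSobolevExponent d s →
      MemLp f (ENNReal.ofReal q) (volume.restrict U) →
      MemLp F (ENNReal.ofReal (2 * q)) (volume.restrict U) →
      (eLpNorm f (ENNReal.ofReal q) (volume.restrict U)).toReal ≤ K →
      (eLpNorm F (ENNReal.ofReal (2 * q)) (volume.restrict U)).toReal ≤ K →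
      HasH10Gradient U u G → WeakFormulation U A B c α f F u G →
      ∀ k δ : ℝ, 0 ≤ k → 0 < δ →
        (volume.restrict U {x | k + δ < |u x|}).toReal ^ (2 / p)
          ≤ D * (K / δ + K ^ 2 / δ ^ 2)
            * (volume.restrict U {x | k < |u x|}).toReal ^ (1 - 1 / q) := by
  obtain ⟨C, hC⟩ := exists_sobolev_const hd V hp hpd
  obtain ⟨L, hL0, hL⟩ := exists_deriv_oddCutoff_le
  have hp0 : 0 < p := by linarith
  -- `C²` is the squared Sobolev constant, `L` comes from `T'² ≤ (L/δ)T'`, `2 / lam` from the energy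
  -- estimate, and the maximum is a common factor for `K/δ` and `K²/δ²`.
  refine ⟨C ^ 2 * L * (2 / lam) * max 1 (L / (2 * lam)), by positivity, ?_⟩
  intro U A B c α s K f u F G hV h hα hs hf hF hfK hFK hu hw k δ hk hδ
  have := h.isFiniteMeasure
  set μ := volume.restrict U with hμ
  have hK : 0 ≤ K := ENNReal.toReal_nonneg.trans hfK
  have hT := isSmoothTruncation_oddCutoff hk hδ
  obtain ⟨L', hL'⟩ := hT.deriv_bounded
  have hTu := hu.comp hT.contDiff hT.zero hL'
  have hf1 : Integrable f μ := hf.integrable (by rw [ENNReal.one_le_ofReal]; exact hq.le)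
  have hF2 : MemLp F 2 μ := hF.mono_exponent (by
    rw [show (2 : ℝ≥0∞) = ENNReal.ofReal 2 by simp]
    exact ENNReal.ofReal_le_ofReal (by linarith))
  have hnull : NullMeasurableSet {x | k < |u x|} μ :=
    nullMeasurableSet_lt aemeasurable_const (hu.memLp.1.aemeasurable.abs)
  -- As `u` is only a.e. measurable, the superlevel set is replaced by a measurable superset of
  -- equal measure.
  obtain ⟨S, hSk, hS, hSae⟩ := hnull.exists_measurable_superset_ae_eq
  set Y : ℝ := (μ {x | k < |u x|}).toReal ^ (1 - 1 / q) with hY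
  have hμS : μ S = μ {x | k < |u x|} := measure_congr hSae
  have hY0 : 0 ≤ Y := by positivity
  have en := hw.energy_oddCutoff h hlam hα hd hs hu hf1 hF2 hk hδ (fun t => hL k δ t hδ) hS
    (ae_of_all _ fun x hx => hSk hx)
  have b1 : ∫ x in S, |f x| ∂μ ≤ K * Y := by
    have := setIntegral_norm_le_rpow hq hf S
    rw [hμS] at this
    exact this.trans (by gcongr)
  have b2 : ∫ x in S, ‖F x‖ ^ 2 ∂μ ≤ K ^ 2 * Y := by
    have hFq : MemLp (fun x => ‖F x‖ ^ 2) (ENNReal.ofReal q) μ := by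
      have := hF.norm_rpow_div 2
      have e : ENNReal.ofReal (2 * q) / 2 = ENNReal.ofReal q := by
        rw [show (2 : ℝ≥0∞) = ENNReal.ofReal 2 by simp, ← ENNReal.ofReal_div_of_pos (by norm_num)]
        congr 1; ring
      rw [e] at this
      simpa using this
    have := setIntegral_norm_le_rpow hq hFq S
    rw [hμS, eLpNorm_norm_sq_toReal F (by linarith)] at this
    simp only [norm_pow, norm_norm] at this
    exact this.trans (by gcongr)
  -- The gradient of `T(u)` carries `T'²`, whereas the energy controls only one power of `T'`; the
  -- other costs `L / δ`.
  have g1 : ∫ x in U, ‖deriv (oddCutoff k δ) (u x) • G x‖ ^ 2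
      ≤ (L / δ) * ∫ x in U, deriv (oddCutoff k δ) (u x) * ‖G x‖ ^ 2 := by
    have iG : Integrable (fun x => deriv (oddCutoff k δ) (u x) * ‖G x‖ ^ 2) μ := by
      refine (hTu.memLp_grad.integrable_real_inner hu.memLp_grad).congr (ae_of_all _ fun x => ?_)
      simp [real_inner_smul_left]
    rw [← integral_const_mul]
    refine integral_mono hTu.memLp_grad.norm.integrable_sq (iG.const_mul _) fun x => ?_
    have h0 := hT.deriv_nonneg (u x)
    simp only [norm_smul, Real.norm_of_nonneg h0, mul_pow]
    have := mul_le_mul_of_nonneg_right (hL k δ (u x) hδ) (mul_nonneg h0 (sq_nonneg ‖G x‖))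
    linarith
  have g2 : (eLpNorm (fun x => deriv (oddCutoff k δ) (u x) • G x) 2 μ).toReal ^ 2
      = ∫ x in U, ‖deriv (oddCutoff k δ) (u x) • G x‖ ^ 2 := by
    have := hTu.memLp_grad.eLpNorm_eq_integral_rpow_norm (by norm_num) (by norm_num)
    rw [this, ENNReal.toReal_ofReal (by positivity)]
    simp only [ENNReal.toReal_ofNat, Real.rpow_ofNat]
    rw [← Real.rpow_natCast, ← Real.rpow_mul (integral_nonneg fun x => by positivity)]
    norm_num
  have sob : (eLpNorm (fun x => oddCutoff k δ (u x)) (ENNReal.ofReal p) μ).toReal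
      ≤ C * (eLpNorm (fun x => deriv (oddCutoff k δ) (u x) • G x) 2 μ).toReal := by
    have := ENNReal.toReal_mono (ENNReal.mul_ne_top ENNReal.coe_ne_top hTu.memLp_grad.2.ne)
      (hC U h.isOpen.measurableSet hV _ _ hTu)
    simpa using this
  -- Chebyshev's inequality, since `|T(u)| = 1` where `|u| > k + δ`.
  have low : (μ {x | k + δ < |u x|}).toReal ^ (1 / p)
      ≤ (eLpNorm (fun x => oddCutoff k δ (u x)) (ENNReal.ofReal p) μ).toReal := by
    have hfin : eLpNorm (fun x => oddCutoff k δ (u x)) (ENNReal.ofReal p) μ ≠ ⊤ :=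
      ((hC U h.isOpen.measurableSet hV _ _ hTu).trans_lt
        (ENNReal.mul_lt_top ENNReal.coe_lt_top hTu.memLp_grad.2)).ne
    have := pow_mul_meas_ge_le_eLpNorm μ (p := ENNReal.ofReal p)
      (by simpa using hp0) ENNReal.ofReal_ne_top hTu.memLp.1 1
    rw [ENNReal.toReal_ofReal hp0.le, one_div, one_mul] at this
    rw [ENNReal.toReal_rpow, one_div]
    refine ENNReal.toReal_mono hfin (le_trans ?_ this)
    refine ENNReal.rpow_le_rpow (measure_mono fun x hx => ?_) (by positivity)
    simp only [Set.mem_ofPred_eq] at hx ⊢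
    have e : ‖oddCutoff k δ (u x)‖ₑ = 1 := by
      rw [← ofReal_norm, Real.norm_eq_abs, abs_oddCutoff_eq_one hk hδ hx.le, ENNReal.ofReal_one]
    rw [e, ENNReal.one_rpow]
  have hsq : (μ {x | k + δ < |u x|}).toReal ^ (2 / p)
      = ((μ {x | k + δ < |u x|}).toReal ^ (1 / p)) ^ 2 := by
    rw [← Real.rpow_natCast, ← Real.rpow_mul ENNReal.toReal_nonneg]
    congr 1
    push_cast; ring
  have en' : ∫ x in U, deriv (oddCutoff k δ) (u x) * ‖G x‖ ^ 2
      ≤ (2 / lam) * ((K + L / (2 * lam) * (K ^ 2 / δ)) * Y) := by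
    have b3 := mul_le_mul_of_nonneg_left b2 (show 0 ≤ 1 / (2 * lam) * (L / δ) by positivity)
    have : ∫ x in U, deriv (oddCutoff k δ) (u x) * ‖G x‖ ^ 2
        = (2 / lam) * ((lam / 2) * ∫ x in U, deriv (oddCutoff k δ) (u x) * ‖G x‖ ^ 2) := by
      field_simp
    rw [this]
    refine mul_le_mul_of_nonneg_left ?_ (by positivity)
    refine en.trans ((add_le_add b1 b3).trans (le_of_eq ?_))
    field_simp
  calc (μ {x | k + δ < |u x|}).toReal ^ (2 / p)
      = ((μ {x | k + δ < |u x|}).toReal ^ (1 / p)) ^ 2 := hsq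
    _ ≤ (C * (eLpNorm (fun x => deriv (oddCutoff k δ) (u x) • G x) 2 μ).toReal) ^ 2 := by
        gcongr; exact low.trans sob
    _ ≤ C ^ 2 * ((L / δ) * ((2 / lam) * ((K + L / (2 * lam) * (K ^ 2 / δ)) * Y))) := by
        rw [mul_pow, g2]
        gcongr
        exact g1.trans (by gcongr)
    _ ≤ C ^ 2 * ((L / δ) * ((2 / lam) * ((max 1 (L / (2 * lam)) * K
          + max 1 (L / (2 * lam)) * (K ^ 2 / δ)) * Y))) := by
        gcongr
        · exact le_mul_of_one_le_left hK (le_max_left _ _)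
        · exact le_max_right _ _
    _ = _ := by field_simp

end Stampacchia

/-! ### The `L^∞` estimate and the `L^r` contraction -/

section Bounds

open Filter Topology

lemma eLpNorm_top_le_ofReal {X : Type*} [MeasurableSpace X] {μ : Measure X} {u : X → ℝ} {M : ℝ}
    (h : μ {x | M < |u x|} = 0) : eLpNorm u ⊤ μ ≤ ENNReal.ofReal M := by
  rw [eLpNorm_exponent_top]
  refine eLpNormEssSup_le_of_ae_bound ?_
  rw [ae_iff]
  simpa using h

/-- Global boundedness of weak solutions. -/
lemma WeakFormulation.exists_eLpNorm_top_le {d : ℕ} (hd : 2 ≤ d) {lam : ℝ} (hlam : 0 < lam)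
    (V : ℝ≥0) {q : ℝ} (hq : (d : ℝ) / 2 < q) :
    ∃ M : ℝ≥0, 0 < M ∧ ∀ (U : Set (EuclideanSpace ℝ (Fin d)))
      (A : EuclideanSpace ℝ (Fin d) → Matrix (Fin d) (Fin d) ℝ)
      (B : EuclideanSpace ℝ (Fin d) → EuclideanSpace ℝ (Fin d))
      (c : EuclideanSpace ℝ (Fin d) → ℝ) (α s : ℝ) (f u : EuclideanSpace ℝ (Fin d) → ℝ)
      (F G : EuclideanSpace ℝ (Fin d) → EuclideanSpace ℝ (Fin d)),
      volume U = V → CoefficientAssumptions s lam U A B c → 0 ≤ α → IsLowerSobolevExponent d s →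
      MemLp f (ENNReal.ofReal q) (volume.restrict U) →
      MemLp F (ENNReal.ofReal (2 * q)) (volume.restrict U) →
      HasH10Gradient U u G → WeakFormulation U A B c α f F u G →
      eLpNorm u ⊤ (volume.restrict U) ≤ M * (eLpNorm f (ENNReal.ofReal q) (volume.restrict U)
        + eLpNorm F (ENNReal.ofReal (2 * q)) (volume.restrict U)) := by
  have hd' : (2 : ℝ) ≤ d := by exact_mod_cast hd
  have hq1 : 1 < q := by linarith
  have hd2 : 1 / (d : ℝ) ≤ 1 / 2 := by gcongr
  have hqd : 1 / (2 * q) < 1 / d := by gcongr; linarith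
  have hq0 : 0 < 1 / (2 * q) := by positivity
  have h2q : 1 / q = 2 * (1 / (2 * q)) := by field_simp
  -- `1/p` is the midpoint of `1/2 - 1/d` and `1/2 - 1/(2q)`, an interval that is nondegenerate
  -- because `q > d/2`. The lower end is the Sobolev condition, the upper one the superlinearity
  -- `2/p < 1 - 1/q`. The choice does not involve `2_*`, hence neither does the bound.
  set p : ℝ := (1 / 2 - 1 / (2 * d) - 1 / (4 * q))⁻¹ with hp
  have hpinv : 1 / p = 1 / 2 - (1 / d) / 2 - (1 / (2 * q)) / 2 := by
    rw [hp, one_div, inv_inv]; field_simp; ring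
  have hpinv0 : 0 < 1 / p := by rw [hpinv]; linarith
  have hp0 : 0 < p := one_div_pos.1 hpinv0
  have hp2 : 2 ≤ p := by
    have : 1 / p ≤ 1 / 2 := by rw [hpinv]; linarith
    exact (one_div_le_one_div hp0 (by norm_num)).1 this
  obtain ⟨D, hD0, hD⟩ := WeakFormulation.exists_decay hd hlam V hp2 (by rw [hpinv]; linarith) hq1
  have h2p : 2 / p = 2 * (1 / p) := by ring
  obtain ⟨M, hM1, hM⟩ := exists_level_of_superlinear_decay (a := 2 / p) (b := 1 - 1 / q)
    (by positivity) (by rw [h2p, hpinv, h2q]; linarith) hD0 V.2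
  have hM0 : 0 < M := by linarith
  refine ⟨M.toNNReal, by simpa using hM0, ?_⟩
  intro U A B c α s f u F G hV h hα hs hf hF hu hw
  have := h.isFiniteMeasure
  set μ := volume.restrict U
  set N := eLpNorm f (ENNReal.ofReal q) μ + eLpNorm F (ENNReal.ofReal (2 * q)) μ with hN
  have hNfin : N ≠ ⊤ := ENNReal.add_ne_top.2 ⟨hf.2.ne, hF.2.ne⟩
  -- The iteration needs a positive `K`, but the data norm `N` may vanish: `K = N + ε/M` is used,
  -- and it contributes exactly the extra `ε`.
  refine ENNReal.le_of_forall_pos_le_add fun ε hε _ => ?_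
  have hK0 : 0 < N.toReal + ε / M := by positivity
  have key := hM (fun t => (μ {x | t < |u x|}).toReal) (N.toReal + ε / M)
    (fun t t' htt' => ENNReal.toReal_mono (measure_ne_top _ _)
      (measure_mono fun x hx => lt_of_le_of_lt htt' hx))
    (fun t => ENNReal.toReal_nonneg)
    (by
      have : μ {x | 0 < |u x|} ≤ V := by
        rw [← hV, ← Measure.restrict_apply_univ U]; exact measure_mono (Set.subset_univ _)
      exact ENNReal.toReal_mono ENNReal.coe_ne_top this)
    hK0
    (hD U A B c α s _ f u F G hV h hα hs hf hF
      ((ENNReal.toReal_mono hNfin le_self_add).trans (by simp; positivity))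
      ((ENNReal.toReal_mono hNfin le_add_self).trans (by simp; positivity)) hu hw)
  refine (eLpNorm_top_le_ofReal ((ENNReal.toReal_eq_zero_iff _).1 key |>.resolve_right
    (measure_ne_top _ _))).trans (le_of_eq ?_)
  rw [mul_add, mul_div_cancel₀ _ hM0.ne', ENNReal.ofReal_add (by positivity) ε.coe_nonneg,
    ENNReal.ofReal_mul hM0.le, ENNReal.ofReal_toReal hNfin, ENNReal.ofReal_coe_nnreal]
  rfl

/-- Domination on all superlevel sets of `|u|` implies domination of all `L^r` norms. -/
lemma eLpNorm_le_of_forall_superlevel {X : Type*} [MeasurableSpace X] {μ : Measure X}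
    [IsFiniteMeasure μ] {u f : X → ℝ} (hu : AEStronglyMeasurable u μ)
    (hf : AEStronglyMeasurable f μ) {α : ℝ} (hα : 0 < α)
    (h : ∀ k : ℝ, 0 ≤ k → ENNReal.ofReal α * ∫⁻ x in {x | k < |u x|}, ‖u x‖ₑ ∂μ
      ≤ ∫⁻ x in {x | k < |u x|}, ‖f x‖ₑ ∂μ) {r : ℝ≥0∞} (hr : 1 ≤ r) :
    eLpNorm u r μ ≤ ENNReal.ofReal α⁻¹ * eLpNorm f r μ := by
  have hα0 : ENNReal.ofReal α ≠ 0 := by simpa using hα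
  have hαinv : ENNReal.ofReal α⁻¹ = (ENNReal.ofReal α)⁻¹ := ENNReal.ofReal_inv_of_pos hα
  have hconv : ∀ {a b : ℝ≥0∞}, ENNReal.ofReal α * a ≤ b → a ≤ ENNReal.ofReal α⁻¹ * b := by
    intro a b hab
    rw [hαinv, mul_comm, ← div_eq_mul_inv,
      ENNReal.le_div_iff_mul_le (Or.inl hα0) (Or.inl ENNReal.ofReal_ne_top), mul_comm]
    exact hab
  rcases eq_or_ne r ⊤ with rfl | hrtop
  · set N := eLpNorm f ⊤ μ with hN
    rcases eq_or_ne N ⊤ with hNt | hNt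
    · rw [hNt, ENNReal.mul_top (by simpa using hα)]; exact le_top
    have hfN : ∀ᵐ x ∂μ, ‖f x‖ₑ ≤ N := by
      rw [hN, eLpNorm_exponent_top]; exact ae_le_eLpNormEssSup
    refine ENNReal.le_of_forall_pos_le_add fun ε hε _ => ?_
    -- Just above `‖f‖_∞ / α` the hypothesis reads `k |S| ≤ (‖f‖_∞/α) |S|`, which forces `S` to be
    -- null.
    set k : ℝ := α⁻¹ * N.toReal + ε with hk
    have hk0 : 0 ≤ k := by positivity
    have hkof : ENNReal.ofReal k = ENNReal.ofReal α⁻¹ * N + ε := by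
      rw [hk, ENNReal.ofReal_add (by positivity) ε.coe_nonneg, ENNReal.ofReal_mul (by positivity),
        ENNReal.ofReal_toReal hNt, ENNReal.ofReal_coe_nnreal]
    rw [← hkof]
    refine eLpNorm_top_le_ofReal ?_
    set S := {x | k < |u x|} with hS
    have hSn : NullMeasurableSet S μ :=
      nullMeasurableSet_lt aemeasurable_const hu.aemeasurable.abs
    have l1 : ENNReal.ofReal k * μ S ≤ ∫⁻ x in S, ‖u x‖ₑ ∂μ := by
      rw [← setLIntegral_const]
      refine lintegral_mono_ae ?_
      filter_upwards [ae_restrict_mem₀ hSn] with x hx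
      rw [← ofReal_norm]
      exact ENNReal.ofReal_le_ofReal (le_of_lt hx)
    have l2 : ∫⁻ x in S, ‖f x‖ₑ ∂μ ≤ N * μ S := by
      rw [← setLIntegral_const]
      exact lintegral_mono_ae (ae_restrict_of_ae hfN)
    have l3 := l1.trans ((hconv (h k hk0)).trans (mul_le_mul_right l2 _))
    rw [← mul_assoc, hkof, add_mul] at l3
    have hfin : ENNReal.ofReal α⁻¹ * N * μ S ≠ ⊤ := by finiteness
    have l4 : (ε : ℝ≥0∞) * μ S ≤ 0 := by
      have : ENNReal.ofReal α⁻¹ * N * μ S + ε * μ S ≤ ENNReal.ofReal α⁻¹ * N * μ S + 0 := by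
        simpa using l3
      exact (ENNReal.add_le_add_iff_left hfin).1 this
    have := nonpos_iff_eq_zero.1 l4
    rcases mul_eq_zero.1 this with h0 | h0
    · exact absurd h0 (by simpa using hε.ne')
    · exact h0
  rcases eq_or_lt_of_le hr with rfl | hr1
  · rw [eLpNorm_one_eq_lintegral_enorm, eLpNorm_one_eq_lintegral_enorm]
    refine hconv ?_
    have e : ∫⁻ x in {x | 0 < |u x|}, ‖u x‖ₑ ∂μ = ∫⁻ x, ‖u x‖ₑ ∂μ := by
      rw [← lintegral_indicator₀ (nullMeasurableSet_lt aemeasurable_const hu.aemeasurable.abs)]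
      refine lintegral_congr fun x => ?_
      by_cases hx : u x = 0 <;> simp [hx]
    rw [← e]
    exact (h 0 le_rfl).trans (setLIntegral_le_lintegral _ _)
  set ρ := r.toReal with hρ
  have hρ1 : 1 < ρ := by
    rw [hρ, ← ENNReal.toReal_one]; exact (ENNReal.toReal_lt_toReal ENNReal.one_ne_top hrtop).2 hr1
  have hρ0 : 0 < ρ := by linarith
  have hr0 : r ≠ 0 := (zero_lt_one.trans hr1).ne'
  have hconj : ρ.HolderConjugate ρ.conjExponent := Real.HolderConjugate.conjExponent hρ1
  -- Truncating `|u|` at height `N` makes `I = ∫ w^ρ` finite, so a power of it can be cancelled at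
  -- the end; the truncation is removed by lower semicontinuity.
  have main : ∀ N : ℕ, eLpNorm (fun x => min |u x| N) r μ
      ≤ ENNReal.ofReal α⁻¹ * eLpNorm f r μ := by
    intro N
    set w : X → ℝ := fun x => min |u x| N with hw
    have hw0 : ∀ x, 0 ≤ w x := fun x => le_min (abs_nonneg _) (Nat.cast_nonneg _)
    have hwm : AEMeasurable w μ := hu.aemeasurable.abs.min aemeasurable_const
    have hue : AEMeasurable (fun x => ENNReal.ofReal α * ‖u x‖ₑ) μ :=
      hu.enorm.const_mul _
    have hfe : AEMeasurable (fun x => ‖f x‖ₑ) μ := hf.enorm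
    have hwp : AEMeasurable (fun x => ENNReal.ofReal (w x ^ (ρ - 1))) μ :=
      (hwm.pow_const _).ennreal_ofReal
    -- The layer-cake formula for `w^{ρ-1}` under the measures `α|u|μ` and `|f|μ`. The superlevel
    -- sets of `w` are those of `|u|` below height `N` and empty from there on, so the hypothesis
    -- compares the two measures on each of them.
    have lc : ∫⁻ x, ENNReal.ofReal (w x ^ (ρ - 1)) ∂(μ.withDensity fun x => ENNReal.ofReal α * ‖u x‖ₑ)
        ≤ ∫⁻ x, ENNReal.ofReal (w x ^ (ρ - 1)) ∂(μ.withDensity fun x => ‖f x‖ₑ) := by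
      rw [lintegral_rpow_eq_lintegral_meas_lt_mul _ (ae_of_all _ hw0)
          (hwm.mono_ac (withDensity_absolutelyContinuous _ _)) (by linarith),
        lintegral_rpow_eq_lintegral_meas_lt_mul _ (ae_of_all _ hw0)
          (hwm.mono_ac (withDensity_absolutelyContinuous _ _)) (by linarith)]
      refine mul_le_mul_right (lintegral_mono_ae ?_) _
      filter_upwards [ae_restrict_mem measurableSet_Ioi] with t ht
      refine mul_le_mul_left ?_ _
      rw [withDensity_apply' _ _, withDensity_apply' _ _]
      by_cases htN : t < N
      · have e : {x | t < w x} = {x | t < |u x|} := by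
          ext x; simp [hw, htN]
        rw [e, lintegral_const_mul' _ _ ENNReal.ofReal_ne_top]
        exact h t (le_of_lt ht)
      · have e : {x | t < w x} = ∅ := by
          ext x; simp only [hw, lt_min_iff, htN, and_false]; rfl
        simp [e]
    rw [lintegral_withDensity_eq_lintegral_mul₀ hue hwp,
      lintegral_withDensity_eq_lintegral_mul₀ hfe hwp] at lc
    set I := ∫⁻ x, ENNReal.ofReal (w x) ^ ρ ∂μ with hI
    have hIfin : I ≠ ⊤ := by
      have : I ≤ ∫⁻ _, ENNReal.ofReal N ^ ρ ∂μ :=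
        lintegral_mono fun x => ENNReal.rpow_le_rpow
          (ENNReal.ofReal_le_ofReal (min_le_right _ _)) hρ0.le
      refine ne_top_of_le_ne_top ?_ this
      rw [lintegral_const]
      exact ENNReal.mul_ne_top (ENNReal.rpow_ne_top_of_nonneg hρ0.le ENNReal.ofReal_ne_top)
        (measure_ne_top _ _)
    have hwN : eLpNorm w r μ = I ^ (1 / ρ) := by
      rw [eLpNorm_eq_lintegral_rpow_enorm_toReal hr0 hrtop]
      simp only [hI, Real.enorm_of_nonneg (hw0 _), hρ]
    have hfN : eLpNorm f r μ = (∫⁻ x, ‖f x‖ₑ ^ ρ ∂μ) ^ (1 / ρ) :=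
      eLpNorm_eq_lintegral_rpow_enorm_toReal hr0 hrtop
    have low : ENNReal.ofReal α * I
        ≤ ∫⁻ x, ((fun x => ENNReal.ofReal α * ‖u x‖ₑ)
          * fun x => ENNReal.ofReal (w x ^ (ρ - 1))) x ∂μ := by
      rw [hI, ← lintegral_const_mul' _ _ ENNReal.ofReal_ne_top]
      refine lintegral_mono fun x => ?_
      simp only [Pi.mul_apply, mul_assoc]
      refine mul_le_mul_right ?_ _
      have e1 : ENNReal.ofReal (w x) ^ ρ
          = ENNReal.ofReal (w x) * ENNReal.ofReal (w x ^ (ρ - 1)) := by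
        rw [← ENNReal.ofReal_mul (hw0 x), ENNReal.ofReal_rpow_of_nonneg (hw0 x) hρ0.le]
        congr 1
        rcases (hw0 x).eq_or_lt with h0 | h0
        · rw [← h0, Real.zero_rpow hρ0.ne', zero_mul]
        · rw [← Real.rpow_one_add' h0.le (by linarith)]; congr 1; ring
      rw [e1]
      refine mul_le_mul_left ?_ _
      rw [← ofReal_norm]
      exact ENNReal.ofReal_le_ofReal (min_le_left _ _)
    -- Hölder's inequality, where `(ρ - 1)ρ' = ρ` reproduces the integral `I`.
    have up : ∫⁻ x, ((fun x => ‖f x‖ₑ) * fun x => ENNReal.ofReal (w x ^ (ρ - 1))) x ∂μ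
        ≤ eLpNorm f r μ * I ^ (1 / ρ.conjExponent) := by
      refine (ENNReal.lintegral_mul_le_Lp_mul_Lq μ hconj hfe hwp).trans (le_of_eq ?_)
      rw [hfN, hI]
      congr 2
      refine lintegral_congr fun x => ?_
      rw [ENNReal.ofReal_rpow_of_nonneg (Real.rpow_nonneg (hw0 x) _) hconj.symm.pos.le,
        ENNReal.ofReal_rpow_of_nonneg (hw0 x) hρ0.le, ← Real.rpow_mul (hw0 x)]
      congr 2
      rw [Real.conjExponent]
      have : ρ - 1 ≠ 0 := by linarith
      field_simp
    have fin := low.trans (lc.trans up)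
    rw [hwN]
    refine hconv ?_
    rcases eq_or_ne I 0 with hI0 | hI0
    · rw [hI0, ENNReal.zero_rpow_of_pos (by positivity), mul_zero]; exact zero_le
    have hIsplit : I = I ^ (1 / ρ) * I ^ (1 / ρ.conjExponent) := by
      rw [← ENNReal.rpow_add _ _ hI0 hIfin, one_div, one_div, hconj.inv_add_inv_eq_one,
        ENNReal.rpow_one]
    have hc0 : I ^ (1 / ρ.conjExponent) ≠ 0 := by
      simp [ENNReal.rpow_eq_zero_iff, hI0, hIfin]
    have hct : I ^ (1 / ρ.conjExponent) ≠ ⊤ :=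
      ENNReal.rpow_ne_top_of_nonneg (one_div_nonneg.2 hconj.symm.pos.le) hIfin
    nth_rewrite 1 [hIsplit] at fin
    rw [← mul_assoc] at fin
    exact (ENNReal.mul_le_mul_iff_left hc0 hct).1 fin
  have hlim : ∀ᵐ x ∂μ, Tendsto (fun N : ℕ => min |u x| (N : ℝ)) atTop (𝓝 |u x|) := by
    refine ae_of_all _ fun x => ?_
    refine tendsto_const_nhds.congr' ?_
    obtain ⟨N₀, hN₀⟩ := exists_nat_ge |u x|
    filter_upwards [eventually_ge_atTop N₀] with N hN
    rw [min_eq_left (hN₀.trans (by exact_mod_cast hN))]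
  have l := Lp.eLpNorm_lim_le_liminf_eLpNorm (p := r)
    (fun N : ℕ => (hu.aemeasurable.abs.min aemeasurable_const).aestronglyMeasurable) _ hlim
  have e : eLpNorm (fun x => |u x|) r μ = eLpNorm u r μ := eLpNorm_norm u
  rw [← e]
  refine l.trans ?_
  refine (liminf_le_liminf (Eventually.of_forall main)).trans (le_of_eq ?_)
  exact liminf_const _

variable {d : ℕ} {U : Set (EuclideanSpace ℝ (Fin d))}
  {A : EuclideanSpace ℝ (Fin d) → Matrix (Fin d) (Fin d) ℝ}
  {B : EuclideanSpace ℝ (Fin d) → EuclideanSpace ℝ (Fin d)}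
  {c f u : EuclideanSpace ℝ (Fin d) → ℝ} {s lam α : ℝ}
  {G : EuclideanSpace ℝ (Fin d) → EuclideanSpace ℝ (Fin d)}

/-- On superlevel sets, `α|u|` is dominated in mean by `|f|`. -/
lemma WeakFormulation.superlevel_le (hw : WeakFormulation U A B c α f 0 u G)
    (h : CoefficientAssumptions s lam U A B c) (hlam : 0 < lam) (hα : 0 < α) (hd : 2 ≤ d)
    (hs : IsLowerSobolevExponent d s) (hu : HasH10Gradient U u G)
    (hf : Integrable f (volume.restrict U)) {k : ℝ} (hk : 0 ≤ k) :
    ENNReal.ofReal α * ∫⁻ x in {x | k < |u x|}, ‖u x‖ₑ ∂volume.restrict U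
      ≤ ∫⁻ x in {x | k < |u x|}, ‖f x‖ₑ ∂volume.restrict U := by
  have := h.isFiniteMeasure
  set μ := volume.restrict U
  -- As `δ n → 0`, `u T(u)` is eventually equal to `|u|` at each point with `|u| > k`. Fatou's lemma
  -- then recovers the sharp superlevel set.
  set δ : ℕ → ℝ := fun n => 1 / ((n : ℝ) + 1) with hδdef
  have hδ : ∀ n, 0 < δ n := fun n => by positivity
  have hT := fun n => isSmoothTruncation_oddCutoff hk (hδ n)
  have mT : ∀ n, AEStronglyMeasurable (fun x => oddCutoff k (δ n) (u x)) μ := fun n =>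
    (hT n).contDiff.continuous.comp_aestronglyMeasurable hu.memLp.1
  have hnull : NullMeasurableSet {x | k < |u x|} μ :=
    nullMeasurableSet_lt aemeasurable_const (hu.memLp.1.aemeasurable.abs)
  have step : ∀ n, ENNReal.ofReal α * ∫⁻ x, ENNReal.ofReal (u x * oddCutoff k (δ n) (u x)) ∂μ
      ≤ ∫⁻ x in {x | k < |u x|}, ‖f x‖ₑ ∂μ := by
    intro n
    have en := hw.energy h hd hs hu hf MemLp.zero (hT n)
    simp only [Pi.zero_apply, norm_zero, zero_mul, mul_zero, integral_zero, add_zero] at en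
    have i0 : 0 ≤ lam * ∫ x in U, deriv (oddCutoff k (δ n)) (u x) * ‖G x‖ ^ 2 :=
      mul_nonneg hlam.le (integral_nonneg fun x =>
        mul_nonneg ((hT n).deriv_nonneg _) (sq_nonneg _))
    have iu : Integrable (fun x => u x * oddCutoff k (δ n) (u x)) μ :=
      (hu.memLp.integrable (by norm_num)).mul_of_bounded (mT n) fun x => abs_oddCutoff_le_one _
    rw [← ofReal_integral_eq_lintegral_ofReal iu (ae_of_all _ fun x => (hT n).mul_nonneg _),
      ← ENNReal.ofReal_mul hα.le]
    refine (ENNReal.ofReal_le_ofReal (show _ ≤ ∫ x in U, f x * oddCutoff k (δ n) (u x) by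
      linarith)).trans ?_
    refine (Real.ofReal_le_enorm _).trans ((enorm_integral_le_lintegral_enorm _).trans ?_)
    rw [← lintegral_indicator₀ hnull]
    refine lintegral_mono fun x => ?_
    by_cases hx : k < |u x|
    · rw [Set.indicator_of_mem (show x ∈ {x | k < |u x|} from hx), enorm_mul]
      refine mul_le_of_le_one_right' ?_
      rw [← ofReal_norm]
      exact ENNReal.ofReal_le_one.2 (abs_oddCutoff_le_one _)
    · rw [oddCutoff_eq_zero (hδ n) (not_lt.1 hx)]
      simp
  have fatou := lintegral_liminf_le' (μ := μ) (u := atTop)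
    (f := fun n x => ENNReal.ofReal (u x * oddCutoff k (δ n) (u x)))
    fun n => (hu.memLp.1.mul (mT n)).aemeasurable.ennreal_ofReal
  have hpt : ∫⁻ x in {x | k < |u x|}, ‖u x‖ₑ ∂μ
      ≤ ∫⁻ x, liminf (fun n => ENNReal.ofReal (u x * oddCutoff k (δ n) (u x))) atTop ∂μ := by
    rw [← lintegral_indicator₀ hnull]
    refine lintegral_mono fun x => ?_
    by_cases hx : k < |u x|
    · rw [Set.indicator_of_mem (show x ∈ {x | k < |u x|} from hx)]
      have hev : ∀ᶠ n in atTop, ENNReal.ofReal (u x * oddCutoff k (δ n) (u x)) = ‖u x‖ₑ := by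
        have h0 : Tendsto δ atTop (𝓝 0) := tendsto_one_div_add_atTop_nhds_zero_nat
        filter_upwards [h0.eventually (gt_mem_nhds (sub_pos.2 hx))] with n hn
        rw [mul_oddCutoff_eq_abs hk (hδ n) (by linarith), ← Real.norm_eq_abs, ofReal_norm]
      rw [liminf_congr hev, liminf_const]
    · rw [Set.indicator_of_notMem (show x ∉ {x | k < |u x|} from hx)]; exact zero_le
  have hdiv : ∀ a b : ℝ≥0∞, a ≤ b / ENNReal.ofReal α ↔ ENNReal.ofReal α * a ≤ b := fun a b => by
    rw [ENNReal.le_div_iff_mul_le (Or.inl (by simpa using hα)) (Or.inl ENNReal.ofReal_ne_top),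
      mul_comm]
  rw [← hdiv]
  refine (hpt.trans fatou).trans ?_
  refine (liminf_le_liminf (Eventually.of_forall fun n => (hdiv _ _).2 (step n))).trans ?_
  rw [liminf_const]

/-- `L^r` contraction. -/
lemma WeakFormulation.eLpNorm_le (hw : WeakFormulation U A B c α f 0 u G)
    (h : CoefficientAssumptions s lam U A B c) (hlam : 0 < lam) (hα : 0 < α) (hd : 2 ≤ d)
    (hs : IsLowerSobolevExponent d s) (hu : HasH10Gradient U u G)
    (hf : Integrable f (volume.restrict U)) {r : ℝ≥0∞} (hr : 1 ≤ r) :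
    eLpNorm u r (volume.restrict U)
      ≤ ENNReal.ofReal α⁻¹ * eLpNorm f r (volume.restrict U) := by
  have := h.isFiniteMeasure
  exact eLpNorm_le_of_forall_superlevel hu.memLp.1 hf.1 hα
    (fun k hk => hw.superlevel_le h hlam hα hd hs hu hf hk) hr

end Bounds

/-! ### Existence -/

section Lions

open Filter Topology InnerProductSpace

variable {Φ X : Type*} [AddCommGroup Φ] [Module ℝ Φ]
  [NormedAddCommGroup X] [InnerProductSpace ℝ X] [CompleteSpace X]

/-- Riesz representation of a linear functional along a linear map into a Hilbert space, by an
element of the closure of the range. -/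
lemma exists_riesz_of_bound (e : Φ →ₗ[ℝ] X) (ℓ : Φ →ₗ[ℝ] ℝ) {N : ℝ} (hN : 0 ≤ N)
    (hℓ : ∀ φ, |ℓ φ| ≤ N * ‖e φ‖) :
    ∃ y : X, y ∈ closure (Set.range e) ∧ ‖y‖ ≤ N ∧ ∀ φ, inner ℝ y (e φ) = ℓ φ := by
  set R := (LinearMap.range e).topologicalClosure with hR
  have hcl : (R : Set X) = closure (Set.range e) := by
    rw [hR, Submodule.topologicalClosure_coe, LinearMap.coe_range]
  have hmem : ∀ φ, e φ ∈ R := fun φ => subset_closure ⟨φ, rfl⟩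
  set e' : Φ →ₗ[ℝ] R := e.codRestrict R hmem with he'
  have hdense : DenseRange e' := by
    intro y
    rw [closure_subtype, ← Set.range_comp]
    exact hcl.subset y.2
  have : CompleteSpace R := (Submodule.isClosed_topologicalClosure _).completeSpace_coe
  have hb : ∀ φ, ‖ℓ φ‖ ≤ N * ‖e' φ‖ := hℓ
  set g : R →L[ℝ] ℝ := ℓ.extendOfNorm e' with hg
  refine ⟨((toDual ℝ R).symm g : R), ?_, ?_, fun φ => ?_⟩
  · exact hcl.subset ((toDual ℝ R).symm g).2
  · change ‖(toDual ℝ R).symm g‖ ≤ N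
    rw [LinearIsometryEquiv.norm_map]
    exact g.opNorm_le_bound hN (LinearMap.norm_extendOfNorm_apply_le hdense N hb)
  · have h1 : inner ℝ ((toDual ℝ R).symm g) (e' φ) = g (e' φ) := toDual_symm_apply
    rw [hg, LinearMap.extendOfNorm_eq hdense ⟨N, hb⟩] at h1
    exact h1

/-- A form of Lions' projection theorem: a coercive bilinear form on a space `Φ` mapped into a
Hilbert space, with partial continuity only, admits generalized solutions. -/
lemma exists_approximate_solution (ι : Φ →ₗ[ℝ] X) (a : Φ →ₗ[ℝ] Φ →ₗ[ℝ] ℝ)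
    (ha : ∀ φ, ∃ C, 0 ≤ C ∧ ∀ ψ, |a φ ψ| ≤ C * ‖ι ψ‖) {lam : ℝ} (hlam : 0 < lam)
    (hcoe : ∀ φ, lam * ‖ι φ‖ ^ 2 ≤ a φ φ) (ℓ : Φ →ₗ[ℝ] ℝ) {N : ℝ} (hN : 0 ≤ N)
    (hℓ : ∀ φ, |ℓ φ| ≤ N * ‖ι φ‖) :
    ∃ (x : X) (ψ : ℕ → Φ), Tendsto (fun n => ι (ψ n)) atTop (𝓝 x) ∧ ‖x‖ ≤ N / lam ∧
      ∀ φ, Tendsto (fun n => a φ (ψ n)) atTop (𝓝 (ℓ φ)) := by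
  choose C hC0 hC using ha
  -- `K φ` represents `a φ` with the test function `φ` held fixed. Keeping `K φ` in the closure of
  -- the range of `ι` makes it unique, which is what yields linearity in `φ`.
  choose K hKmem _ hK using fun φ => exists_riesz_of_bound ι (a φ) (hC0 φ) (hC φ)
  have hKR : ∀ φ, K φ ∈ (LinearMap.range ι).topologicalClosure := fun φ => by
    rw [← SetLike.mem_coe, Submodule.topologicalClosure_coe, LinearMap.coe_range]; exact hKmem φ
  have huniq : ∀ y ∈ (LinearMap.range ι).topologicalClosure,
      (∀ ψ, inner ℝ y (ι ψ) = 0) → y = 0 := by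
    intro y hy h0
    rw [← inner_self_eq_zero (𝕜 := ℝ)]
    have hcl : IsClosed {z : X | inner ℝ y z = 0} := isClosed_eq (by fun_prop) (by fun_prop)
    rw [← SetLike.mem_coe, Submodule.topologicalClosure_coe, LinearMap.coe_range] at hy
    exact closure_minimal (by rintro _ ⟨ψ, rfl⟩; exact h0 ψ) hcl hy
  let Kl : Φ →ₗ[ℝ] X :=
    { toFun := K
      map_add' := fun φ φ' => by
        rw [← sub_eq_zero]
        refine huniq _ (Submodule.sub_mem _ (hKR _) (Submodule.add_mem _ (hKR _) (hKR _)))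
          fun ψ => ?_
        rw [inner_sub_left, inner_add_left, hK, hK, hK]
        simp
      map_smul' := fun t φ => by
        rw [← sub_eq_zero]
        refine huniq _ (Submodule.sub_mem _ (hKR _) (Submodule.smul_mem _ _ (hKR _)))
          fun ψ => ?_
        rw [inner_sub_left, RingHom.id_apply, real_inner_smul_left, hK, hK]
        simp }
  -- Coercivity bounds `K` from below, so `ℓ` is bounded relative to `‖K φ‖` and can be represented
  -- a second time, along `K`. The representing vector is a limit of elements `ι ψ` because it lies
  -- in the closure of the range of `K`.
  have hKlow : ∀ φ, lam * ‖ι φ‖ ≤ ‖Kl φ‖ := by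
    intro φ
    rcases (norm_nonneg (ι φ)).eq_or_lt with h0 | h0
    · rw [← h0, mul_zero]; exact norm_nonneg _
    · have h1 : inner ℝ (K φ) (ι φ) ≤ ‖K φ‖ * ‖ι φ‖ := real_inner_le_norm _ _
      have h2 := hcoe φ
      rw [hK] at h1
      refine le_of_mul_le_mul_right ?_ h0
      calc lam * ‖ι φ‖ * ‖ι φ‖ = lam * ‖ι φ‖ ^ 2 := by ring
        _ ≤ _ := h2.trans h1
  obtain ⟨x, hxmem, hxN, hx⟩ := exists_riesz_of_bound Kl ℓ (N := N / lam) (by positivity)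
    fun φ => by
      refine (hℓ φ).trans ?_
      rw [div_mul_eq_mul_div, le_div_iff₀ hlam, mul_assoc, mul_comm _ lam]
      exact mul_le_mul_of_nonneg_left (hKlow φ) hN
  have hxcl : x ∈ closure (Set.range ι) := by
    have : closure (Set.range Kl) ⊆ closure (Set.range ι) :=
      closure_minimal (by rintro _ ⟨φ, rfl⟩; exact hKmem φ) isClosed_closure
    exact this hxmem
  obtain ⟨z, hz, hzx⟩ := mem_closure_iff_seq_limit.1 hxcl
  choose ψ hψ using hz
  refine ⟨x, ψ, by simpa only [hψ] using hzx, hxN, fun φ => ?_⟩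
  have hφ : inner ℝ (K φ) x = ℓ φ := by rw [real_inner_comm]; exact hx φ
  have e : ∀ n, a φ (ψ n) = inner ℝ (K φ) (z n) := fun n => by rw [← hK, hψ]
  simp only [e, ← hφ]
  exact tendsto_const_nhds.inner hzx

end Lions

/-! ### Lions' theorem applied to gradients of test functions -/

section Existence

open Filter Topology

variable {d : ℕ}

/-- The space of test functions. -/
def testFunctions (U : Set (EuclideanSpace ℝ (Fin d))) :
    Submodule ℝ (EuclideanSpace ℝ (Fin d) → ℝ) where
  carrier := {φ | IsTestFunction U φ}
  add_mem' h h' := h.add h'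
  zero_mem' := IsTestFunction.zero
  smul_mem' a _ h := h.smul a

/-- The gradient as a map from test functions to `L²`. -/
noncomputable def gradientLp (U : Set (EuclideanSpace ℝ (Fin d))) :
    testFunctions U →ₗ[ℝ] Lp (EuclideanSpace ℝ (Fin d)) 2 (volume.restrict U) where
  toFun φ := (IsTestFunction.memLp_gradient φ.2 2).toLp
  map_add' φ ψ := by
    rw [← MemLp.toLp_add]
    exact MemLp.toLp_congr _ _ (by rw [← IsTestFunction.gradient_add φ.2 ψ.2]; rfl)
  map_smul' a φ := by
    rw [RingHom.id_apply, ← MemLp.toLp_const_smul]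
    exact MemLp.toLp_congr _ _ (by rw [← IsTestFunction.gradient_smul φ.2 a]; rfl)

variable {U : Set (EuclideanSpace ℝ (Fin d))}
  {A : EuclideanSpace ℝ (Fin d) → Matrix (Fin d) (Fin d) ℝ}
  {B : EuclideanSpace ℝ (Fin d) → EuclideanSpace ℝ (Fin d)}
  {c f u v φ : EuclideanSpace ℝ (Fin d) → ℝ} {s lam α : ℝ}
  {F G G' : EuclideanSpace ℝ (Fin d) → EuclideanSpace ℝ (Fin d)}

lemma norm_gradientLp (φ : testFunctions U) :
    ‖gradientLp U φ‖ = (eLpNorm (gradient (φ : EuclideanSpace ℝ (Fin d) → ℝ)) 2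
      (volume.restrict U)).toReal :=
  Lp.norm_toLp _ (IsTestFunction.memLp_gradient φ.2 2)

/-- The integrand of the weak formulation. -/
noncomputable def weakIntegrand (A : EuclideanSpace ℝ (Fin d) → Matrix (Fin d) (Fin d) ℝ)
    (B : EuclideanSpace ℝ (Fin d) → EuclideanSpace ℝ (Fin d))
    (c : EuclideanSpace ℝ (Fin d) → ℝ) (α : ℝ) (u : EuclideanSpace ℝ (Fin d) → ℝ)
    (G : EuclideanSpace ℝ (Fin d) → EuclideanSpace ℝ (Fin d))
    (φ : EuclideanSpace ℝ (Fin d) → ℝ) (x : EuclideanSpace ℝ (Fin d)) : ℝ :=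
  inner ℝ ((A x).toEuclideanLin (G x)) (gradient φ x)
      + (inner ℝ (B x) (G x) + (c x + α) * u x) * φ x

namespace CoefficientAssumptions

lemma integrable_weakIntegrand (h : CoefficientAssumptions s lam U A B c) (hd : 2 ≤ d)
    (hs : IsLowerSobolevExponent d s) (hu : HasH10Gradient U u G) (hφ : IsTestFunction U φ) :
    Integrable (weakIntegrand A B c α u G φ) (volume.restrict U) :=
  (hφ.integrable_inner (h.memLp_mul hu.memLp_grad)).add
    (hφ.integrable_mul (h.integrable_lower hd hs hu α))

lemma integral_weakIntegrand_sub (h : CoefficientAssumptions s lam U A B c) (hd : 2 ≤ d)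
    (hs : IsLowerSobolevExponent d s) (hu : HasH10Gradient U u G) (hv : HasH10Gradient U v G')
    (hφ : IsTestFunction U φ) :
    ∫ x in U, weakIntegrand A B c α (u - v) (G - G') φ x
      = (∫ x in U, weakIntegrand A B c α u G φ x) - ∫ x in U, weakIntegrand A B c α v G' φ x := by
  rw [← integral_sub (h.integrable_weakIntegrand hd hs hu hφ)
    (h.integrable_weakIntegrand hd hs hv hφ)]
  congr 1 with x
  simp only [weakIntegrand, Pi.sub_apply, map_sub, inner_sub_left, inner_sub_right]
  ring

/-- The constant involves the supremum of `φ`, so boundedness holds only for one fixed test function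
at a time, which is all that `exists_approximate_solution` requires. The zeroth-order term is
controlled by `∇u` through the Sobolev inequality. -/
lemma exists_abs_integral_weakIntegrand_le (h : CoefficientAssumptions s lam U A B c) (hd : 2 ≤ d)
    (hs : IsLowerSobolevExponent d s) (α : ℝ) (hφ : IsTestFunction U φ) :
    ∃ C : ℝ, 0 ≤ C ∧ ∀ (u : EuclideanSpace ℝ (Fin d) → ℝ)
      (G : EuclideanSpace ℝ (Fin d) → EuclideanSpace ℝ (Fin d)), HasH10Gradient U u G →
      |∫ x in U, weakIntegrand A B c α u G φ x|
        ≤ C * (eLpNorm G 2 (volume.restrict U)).toReal := by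
  have := h.isFiniteMeasure
  have hfin : volume U ≠ ⊤ := h.isBounded.measure_lt_top.ne
  have := hs.holderTriple
  obtain ⟨L, hL⟩ := h.exists_norm_le
  obtain ⟨M, hM⟩ := hφ.exists_bound
  obtain ⟨C, hC⟩ := exists_sobolev_const hd (volume U).toNNReal hs.two_le_conj hs.le_one_div_conj
  set μ := volume.restrict U
  have m1 : MemLp (L • gradient φ) 2 μ := (hφ.memLp_gradient 2).const_smul L
  have m2 : MemLp (M • B) 2 μ := h.memLp_B.const_smul M
  have m3 : MemLp (fun x => M * (c x + α)) (ENNReal.ofReal s) μ :=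
    (h.memLp_c.add (memLp_const α)).const_mul M
  refine ⟨(eLpNorm (L • gradient φ) 2 μ).toReal + (eLpNorm (M • B) 2 μ).toReal
    + (eLpNorm (fun x => M * (c x + α)) (ENNReal.ofReal s) μ).toReal * C, by positivity,
    fun u G hu => ?_⟩
  have i1 := hφ.integrable_inner (h.memLp_mul hu.memLp_grad)
  have i2 := hφ.integrable_mul (h.memLp_B.integrable_real_inner hu.memLp_grad)
  have i3 := hφ.integrable_mul (h.integrable_potential_mul (α := α) hs hu.memLp
    (hu.memLp_conj hd hs h.isOpen.measurableSet))
  have b1 : |∫ x in U, inner ℝ ((A x).toEuclideanLin (G x)) (gradient φ x)|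
      ≤ (eLpNorm G 2 μ).toReal * (eLpNorm (L • gradient φ) 2 μ).toReal := by
    refine abs_integral_le_of_holder hu.memLp_grad m1 ?_
    refine ae_restrict_of_forall_mem h.isOpen.measurableSet fun x hx => ?_
    refine (norm_inner_le_norm _ _).trans ?_
    rw [Pi.smul_apply, norm_smul, ← mul_assoc]
    refine mul_le_mul_of_nonneg_right ((hL x hx _).trans ?_) (norm_nonneg _)
    rw [mul_comm]
    exact mul_le_mul_of_nonneg_left (le_abs_self L) (norm_nonneg _)
  have b2 : |∫ x in U, inner ℝ (B x) (G x) * φ x|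
      ≤ (eLpNorm G 2 μ).toReal * (eLpNorm (M • B) 2 μ).toReal := by
    refine abs_integral_le_of_holder hu.memLp_grad m2 (ae_of_all _ fun x => ?_)
    rw [norm_mul, Pi.smul_apply, norm_smul]
    calc ‖inner ℝ (B x) (G x)‖ * ‖φ x‖ ≤ (‖B x‖ * ‖G x‖) * ‖M‖ :=
          mul_le_mul (norm_inner_le_norm _ _) ((hM x).trans (le_abs_self M)) (norm_nonneg _)
            (by positivity)
      _ = _ := by ring
  have b3 : |∫ x in U, (c x + α) * u x * φ x|
      ≤ (eLpNorm (fun x => M * (c x + α)) (ENNReal.ofReal s) μ).toReal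
        * (eLpNorm u (ENNReal.ofReal s.conjExponent) μ).toReal := by
    refine abs_integral_le_of_holder m3 (hu.memLp_conj hd hs h.isOpen.measurableSet)
      (ae_of_all _ fun x => ?_)
    rw [norm_mul, norm_mul, norm_mul]
    calc ‖c x + α‖ * ‖u x‖ * ‖φ x‖ ≤ ‖c x + α‖ * ‖u x‖ * ‖M‖ :=
          mul_le_mul_of_nonneg_left ((hM x).trans (le_abs_self M)) (by positivity)
      _ = _ := by ring
  have b4 : (eLpNorm u (ENNReal.ofReal s.conjExponent) μ).toReal
      ≤ C * (eLpNorm G 2 μ).toReal := by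
    have := ENNReal.toReal_mono (ENNReal.mul_ne_top ENNReal.coe_ne_top hu.memLp_grad.2.ne)
      (hC U h.isOpen.measurableSet (ENNReal.coe_toNNReal hfin).symm u G hu)
    simpa using this
  have e : ∫ x in U, weakIntegrand A B c α u G φ x
      = (∫ x in U, inner ℝ ((A x).toEuclideanLin (G x)) (gradient φ x))
        + ((∫ x in U, inner ℝ (B x) (G x) * φ x) + ∫ x in U, (c x + α) * u x * φ x) := by
    rw [← integral_add i2 i3]
    refine Eq.trans ?_ (integral_add i1 (i2.add i3))
    simp only [weakIntegrand, add_mul]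
  rw [e]
  have b5 := mul_le_mul_of_nonneg_left b4 (ENNReal.toReal_nonneg
    (a := eLpNorm (fun x => M * (c x + α)) (ENNReal.ofReal s) μ))
  have t1 := abs_add_le (∫ x in U, inner ℝ ((A x).toEuclideanLin (G x)) (gradient φ x))
    ((∫ x in U, inner ℝ (B x) (G x) * φ x) + ∫ x in U, (c x + α) * u x * φ x)
  have t2 := abs_add_le (∫ x in U, inner ℝ (B x) (G x) * φ x) (∫ x in U, (c x + α) * u x * φ x)
  linarith

/-- Coercivity on test functions. -/
lemma coercive (h : CoefficientAssumptions s lam U A B c) (hd : 2 ≤ d)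
    (hs : IsLowerSobolevExponent d s) (hα : 0 ≤ α) (hφ : IsTestFunction U φ) :
    lam * (eLpNorm (gradient φ) 2 (volume.restrict U)).toReal ^ 2
      ≤ ∫ x in U, weakIntegrand A B c α φ (gradient φ) φ x := by
  have hu := hφ.hasH10Gradient
  have i1 := hφ.integrable_inner (h.memLp_mul hu.memLp_grad)
  have i2 := hφ.integrable_mul (h.memLp_B.integrable_real_inner hu.memLp_grad)
  have := h.isFiniteMeasure
  have i3 := hφ.integrable_mul (h.integrable_potential_mul (α := α) hs hu.memLp
    (hu.memLp_conj hd hs h.isOpen.measurableSet))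
  have e : ∫ x in U, weakIntegrand A B c α φ (gradient φ) φ x
      = (∫ x in U, inner ℝ ((A x).toEuclideanLin (gradient φ x)) (gradient φ x))
        + ((∫ x in U, inner ℝ (B x) (gradient φ x) * φ x) + ∫ x in U, (c x + α) * φ x * φ x) := by
    rw [← integral_add i2 i3]
    refine Eq.trans ?_ (integral_add i1 (i2.add i3))
    simp only [weakIntegrand, add_mul]
  have c1 : lam * (eLpNorm (gradient φ) 2 (volume.restrict U)).toReal ^ 2
      ≤ ∫ x in U, inner ℝ ((A x).toEuclideanLin (gradient φ x)) (gradient φ x) := by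
    have e2 : (eLpNorm (gradient φ) 2 (volume.restrict U)).toReal ^ 2
        = ∫ x in U, ‖gradient φ x‖ ^ 2 := by
      rw [hu.memLp_grad.eLpNorm_eq_integral_rpow_norm (by norm_num) (by norm_num),
        ENNReal.toReal_ofReal (by positivity)]
      simp only [ENNReal.toReal_ofNat, Real.rpow_ofNat]
      rw [← Real.rpow_natCast, ← Real.rpow_mul (integral_nonneg fun x => by positivity)]
      norm_num
    rw [e2, ← integral_const_mul]
    refine integral_mono_ae (hu.memLp_grad.norm.integrable_sq.const_mul lam) i1 ?_
    exact ae_restrict_of_forall_mem h.isOpen.measurableSet fun x hx => h.elliptic x hx _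
  -- The condition on `div B` is applied to the nonnegative test function `φ²`.
  have c2 : 0 ≤ ∫ x in U, inner ℝ (B x) (gradient φ x) * φ x := by
    have hsq : ContDiff ℝ ∞ fun t : ℝ => t ^ 2 := by fun_prop
    have := h.div_B_nonpos _ (hφ.comp hsq (by simp)) fun x => sq_nonneg _
    rw [hφ.gradient_comp hsq] at this
    have e3 : ∫ x in U, inner ℝ (B x) (deriv (fun t : ℝ => t ^ 2) (φ x) • gradient φ x)
        = 2 * ∫ x in U, inner ℝ (B x) (gradient φ x) * φ x := by
      rw [← integral_const_mul]
      congr 1 with x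
      simp only [real_inner_smul_right, deriv_pow_field]
      push_cast; ring
    rw [e3] at this
    linarith
  have c3 : 0 ≤ ∫ x in U, (c x + α) * φ x * φ x := by
    refine integral_nonneg_of_ae ?_
    filter_upwards [h.c_nonneg] with x hx
    rw [mul_assoc]
    exact mul_nonneg (add_nonneg hx hα) (mul_self_nonneg _)
  rw [e]
  linarith

/-- The bilinear form on test functions, with the test function first. -/
noncomputable def testForm (h : CoefficientAssumptions s lam U A B c) (hd : 2 ≤ d)
    (hs : IsLowerSobolevExponent d s) (α : ℝ) :
    testFunctions U →ₗ[ℝ] testFunctions U →ₗ[ℝ] ℝ :=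
  LinearMap.mk₂ ℝ
    (fun φ ψ => ∫ x in U, weakIntegrand A B c α (ψ : EuclideanSpace ℝ (Fin d) → ℝ)
      (gradient (ψ : EuclideanSpace ℝ (Fin d) → ℝ)) (φ : EuclideanSpace ℝ (Fin d) → ℝ) x)
    (fun φ φ' ψ => by
      rw [← integral_add
        (h.integrable_weakIntegrand hd hs (IsTestFunction.hasH10Gradient ψ.2) φ.2)
        (h.integrable_weakIntegrand hd hs (IsTestFunction.hasH10Gradient ψ.2) φ'.2)]
      congr 1 with x
      simp only [weakIntegrand, Submodule.coe_add, IsTestFunction.gradient_add φ.2 φ'.2,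
        Pi.add_apply, inner_add_right]
      ring)
    (fun t φ ψ => by
      rw [smul_eq_mul, ← integral_const_mul]
      congr 1 with x
      simp only [weakIntegrand, Submodule.coe_smul, IsTestFunction.gradient_smul φ.2 t,
        Pi.smul_apply, real_inner_smul_right, smul_eq_mul]
      ring)
    (fun φ ψ ψ' => by
      rw [← integral_add
        (h.integrable_weakIntegrand hd hs (IsTestFunction.hasH10Gradient ψ.2) φ.2)
        (h.integrable_weakIntegrand hd hs (IsTestFunction.hasH10Gradient ψ'.2) φ.2)]
      congr 1 with x
      simp only [weakIntegrand, Submodule.coe_add, IsTestFunction.gradient_add ψ.2 ψ'.2,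
        Pi.add_apply, inner_add_right, map_add, inner_add_left]
      ring)
    (fun t φ ψ => by
      rw [smul_eq_mul, ← integral_const_mul]
      congr 1 with x
      simp only [weakIntegrand, Submodule.coe_smul, IsTestFunction.gradient_smul ψ.2 t,
        Pi.smul_apply, real_inner_smul_right, smul_eq_mul, map_smul, real_inner_smul_left]
      ring)

end CoefficientAssumptions

/-- The right-hand side of the weak formulation as a functional on test functions. -/
noncomputable def testFunctional (hf : Integrable f (volume.restrict U))
    (hF : MemLp F 2 (volume.restrict U)) : testFunctions U →ₗ[ℝ] ℝ where
  toFun φ := ∫ x in U, (f x * (φ : EuclideanSpace ℝ (Fin d) → ℝ) x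
    + inner ℝ (F x) (gradient (φ : EuclideanSpace ℝ (Fin d) → ℝ) x))
  map_add' φ ψ := by
    refine Eq.trans ?_ (integral_add
      ((IsTestFunction.integrable_mul φ.2 hf).add (IsTestFunction.integrable_inner φ.2 hF))
      ((IsTestFunction.integrable_mul ψ.2 hf).add (IsTestFunction.integrable_inner ψ.2 hF)))
    congr 1 with x
    simp only [Submodule.coe_add, IsTestFunction.gradient_add φ.2 ψ.2, Pi.add_apply,
      inner_add_right]
    ring
  map_smul' t φ := by
    rw [RingHom.id_apply, smul_eq_mul, ← integral_const_mul]
    congr 1 with x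
    simp only [Submodule.coe_smul, IsTestFunction.gradient_smul φ.2 t, Pi.smul_apply,
      real_inner_smul_right, smul_eq_mul]
    ring

/-- By the Poincaré inequality (the Sobolev inequality with `p = 2`), convergence of the gradients
makes the functions themselves Cauchy in `L²`; the limit of the gradients is thus the gradient of
their limit. -/
lemma exists_hasH10Gradient_of_tendsto (hd : 2 ≤ d) (hU : MeasurableSet U) (hUfin : volume U ≠ ⊤)
    {ψ : ℕ → testFunctions U} {x : Lp (EuclideanSpace ℝ (Fin d)) 2 (volume.restrict U)}
    (hψ : Tendsto (fun n => gradientLp U (ψ n)) atTop (𝓝 x)) :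
    (∃ u, HasH10Gradient U u x) ∧
      Tendsto (fun n => eLpNorm (gradient (ψ n : EuclideanSpace ℝ (Fin d) → ℝ) - ⇑x) 2
        (volume.restrict U)) atTop (𝓝 0) := by
  have hd' : (2 : ℝ) ≤ d := by exact_mod_cast hd
  have hψt : ∀ n, IsTestFunction U (ψ n : EuclideanSpace ℝ (Fin d) → ℝ) := fun n => (ψ n).2
  have t2 : Tendsto (fun n => eLpNorm (gradient (ψ n : EuclideanSpace ℝ (Fin d) → ℝ) - ⇑x) 2
      (volume.restrict U)) atTop (𝓝 0) := by
    rw [← Lp.toLp_coeFn x (Lp.memLp x)] at hψ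
    exact (Lp.tendsto_Lp_iff_tendsto_eLpNorm'' _ (fun n => (hψt n).memLp_gradient 2) x
      (Lp.memLp x)).1 hψ
  obtain ⟨C, hC⟩ := exists_sobolev_const hd (volume U).toNNReal (p := 2) le_rfl
    (by have : 0 < 1 / (d : ℝ) := by positivity
        linarith)
  have hdist : ∀ m n, dist (((hψt m).memLp 2).toLp) (((hψt n).memLp 2).toLp)
      ≤ C * dist (gradientLp U (ψ m)) (gradientLp U (ψ n)) := by
    intro m n
    have hmn := hC U hU (ENNReal.coe_toNNReal hUfin).symm _ _
      ((hψt m).sub (hψt n)).hasH10Gradient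
    rw [dist_eq_norm, dist_eq_norm, ← map_sub, norm_gradientLp, ← MemLp.toLp_sub, Lp.norm_toLp]
    have := ENNReal.toReal_mono (ENNReal.mul_ne_top ENNReal.coe_ne_top
      (((hψt m).sub (hψt n)).memLp_gradient 2).2.ne) hmn
    simpa using this
  have hcau : CauchySeq fun n => ((hψt n).memLp 2).toLp := by
    rw [cauchySeq_iff_tendsto_dist_atTop_0]
    have := (cauchySeq_iff_tendsto_dist_atTop_0.1 hψ.cauchySeq).const_mul (C : ℝ)
    rw [mul_zero] at this
    exact squeeze_zero (fun _ => dist_nonneg) (fun p => hdist p.1 p.2) this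
  obtain ⟨w, hw⟩ := cauchySeq_tendsto_of_complete hcau
  rw [← Lp.toLp_coeFn w (Lp.memLp w)] at hw
  have t1 := (Lp.tendsto_Lp_iff_tendsto_eLpNorm'' _ (fun n => (hψt n).memLp 2) w
      (Lp.memLp w)).1 hw
  exact ⟨⟨w, Lp.memLp w, Lp.memLp x, fun n => ψ n, hψt, t1, t2⟩, t2⟩

/-- Existence of weak solutions with an energy estimate. -/
lemma CoefficientAssumptions.exists_weakFormulation (h : CoefficientAssumptions s lam U A B c)
    (hlam : 0 < lam) (hα : 0 ≤ α) (hd : 2 ≤ d) (hs : IsLowerSobolevExponent d s) {C : ℝ≥0}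
    (hC : ∀ φ, IsTestFunction U φ → eLpNorm φ (ENNReal.ofReal s.conjExponent) (volume.restrict U)
      ≤ C * eLpNorm (gradient φ) 2 (volume.restrict U))
    (hf : MemLp f (ENNReal.ofReal s) (volume.restrict U)) (hF : MemLp F 2 (volume.restrict U)) :
    ∃ u G, HasH10Gradient U u G ∧ WeakFormulation U A B c α f F u G ∧
      eLpNorm G 2 (volume.restrict U) ≤ ENNReal.ofReal lam⁻¹
        * (C * eLpNorm f (ENNReal.ofReal s) (volume.restrict U)
          + eLpNorm F 2 (volume.restrict U)) := by
  have := h.isFiniteMeasure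
  have := hs.holderTriple
  have hf1 : Integrable f (volume.restrict U) := hf.integrable hs.one_le_ofReal
  set N : ℝ≥0∞ := C * eLpNorm f (ENNReal.ofReal s) (volume.restrict U)
    + eLpNorm F 2 (volume.restrict U) with hN
  have hNfin : N ≠ ⊤ :=
    ENNReal.add_ne_top.2 ⟨ENNReal.mul_ne_top ENNReal.coe_ne_top hf.2.ne, hF.2.ne⟩
  obtain ⟨x, ψ, hψ, hx, hlim⟩ := exists_approximate_solution (gradientLp U) (h.testForm hd hs α)
    (fun φ => by
      obtain ⟨K, hK0, hK⟩ := h.exists_abs_integral_weakIntegrand_le hd hs α φ.2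
      refine ⟨K, hK0, fun ψ => ?_⟩
      rw [norm_gradientLp]
      exact hK _ _ (IsTestFunction.hasH10Gradient ψ.2))
    hlam (fun φ => by rw [norm_gradientLp]; exact h.coercive hd hs hα φ.2)
    (testFunctional hf1 hF) (N := N.toReal) ENNReal.toReal_nonneg
    (fun φ => by
      have hφ : IsTestFunction U (φ : EuclideanSpace ℝ (Fin d) → ℝ) := φ.2
      have e : testFunctional hf1 hF φ
          = (∫ x in U, f x * (φ : EuclideanSpace ℝ (Fin d) → ℝ) x)
            + ∫ x in U, inner ℝ (F x) (gradient (φ : EuclideanSpace ℝ (Fin d) → ℝ) x) :=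
        integral_add (hφ.integrable_mul hf1) (hφ.integrable_inner hF)
      have b1 := abs_integral_le_of_holder hf (hφ.memLp (ENNReal.ofReal s.conjExponent))
        (h := fun x => f x * (φ : EuclideanSpace ℝ (Fin d) → ℝ) x)
        (ae_of_all _ fun x => (norm_mul _ _).le)
      have b2 := abs_integral_le_of_holder hF (hφ.memLp_gradient 2)
        (h := fun x => inner ℝ (F x) (gradient (φ : EuclideanSpace ℝ (Fin d) → ℝ) x))
        (ae_of_all _ fun x => norm_inner_le_norm _ _)
      have b3 := ENNReal.toReal_mono (ENNReal.mul_ne_top ENNReal.coe_ne_top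
        (hφ.memLp_gradient 2).2.ne) (hC _ hφ)
      rw [ENNReal.toReal_mul, ENNReal.coe_toReal] at b3
      have b4 := mul_le_mul_of_nonneg_left b3 (ENNReal.toReal_nonneg
        (a := eLpNorm f (ENNReal.ofReal s) (volume.restrict U)))
      rw [e, norm_gradientLp, hN, ENNReal.toReal_add (ENNReal.mul_ne_top ENNReal.coe_ne_top
        hf.2.ne) hF.2.ne, ENNReal.toReal_mul, ENNReal.coe_toReal]
      refine (abs_add_le _ _).trans ((add_le_add (b1.trans b4) b2).trans (le_of_eq ?_))
      ring)
  obtain ⟨⟨u, hu⟩, hgrad⟩ := exists_hasH10Gradient_of_tendsto hd h.isOpen.measurableSet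
    h.isBounded.measure_lt_top.ne hψ
  refine ⟨u, x, hu, fun φ hφ => ?_, ?_⟩
  · obtain ⟨K, hK0, hK⟩ := h.exists_abs_integral_weakIntegrand_le hd hs α hφ
    -- For fixed `φ` the form is continuous in the gradient norm of its other argument, so the
    -- values on `ψ n` also converge to the value on `(u, x)`.
    refine tendsto_nhds_unique ?_ (hlim ⟨φ, hφ⟩)
    change Tendsto (fun n => ∫ y in U, weakIntegrand A B c α (ψ n : EuclideanSpace ℝ (Fin d) → ℝ)
      (gradient (ψ n : EuclideanSpace ℝ (Fin d) → ℝ)) φ y) atTop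
      (𝓝 (∫ y in U, weakIntegrand A B c α u x φ y))
    rw [tendsto_iff_dist_tendsto_zero]
    have hz : Tendsto (fun n => K * (eLpNorm (gradient (ψ n : EuclideanSpace ℝ (Fin d) → ℝ) - ⇑x) 2
        (volume.restrict U)).toReal) atTop (𝓝 0) := by
      simpa using ((ENNReal.continuousAt_toReal ENNReal.zero_ne_top).tendsto.comp
        hgrad).const_mul K
    refine squeeze_zero (fun _ => dist_nonneg) (fun n => ?_) hz
    have hψn : HasH10Gradient U (ψ n : EuclideanSpace ℝ (Fin d) → ℝ) _ :=
      IsTestFunction.hasH10Gradient (ψ n).2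
    rw [Real.dist_eq, ← h.integral_weakIntegrand_sub hd hs hψn hu hφ]
    exact hK _ _ (hψn.sub hu)
  · rw [← ENNReal.ofReal_toReal hNfin, ← ENNReal.ofReal_mul (by positivity),
      ENNReal.le_ofReal_iff_toReal_le (Lp.memLp x).2.ne (by positivity), ← Lp.norm_def]
    rwa [div_eq_inv_mul] at hx

end Existence

/-! ### Well-posedness -/

section WellPosedness

variable {d : ℕ} {U : Set (EuclideanSpace ℝ (Fin d))}
  {A : EuclideanSpace ℝ (Fin d) → Matrix (Fin d) (Fin d) ℝ}
  {B : EuclideanSpace ℝ (Fin d) → EuclideanSpace ℝ (Fin d)}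
  {c f f' u v : EuclideanSpace ℝ (Fin d) → ℝ} {s lam α : ℝ}
  {F F' G G' : EuclideanSpace ℝ (Fin d) → EuclideanSpace ℝ (Fin d)}

lemma IsWeakSolution.hasH10Gradient (hu : IsWeakSolution U A B c α f F u)
    (h : CoefficientAssumptions s lam U A B c) : HasH10Gradient U u (weakGradient U u) := by
  have := h.isFiniteMeasure
  exact hu.1.hasH10Gradient h.isOpen

lemma IsWeakSolution.weakFormulation (hu : IsWeakSolution U A B c α f F u) :
    WeakFormulation U A B c α f F u (weakGradient U u) :=
  fun φ hφ => (hu.2 φ hφ).2.2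

lemma WeakFormulation.isWeakSolution (hw : WeakFormulation U A B c α f F u G)
    (h : CoefficientAssumptions s lam U A B c) (hd : 2 ≤ d) (hs : IsLowerSobolevExponent d s)
    (hu : HasH10Gradient U u G) (hf : Integrable f (volume.restrict U))
    (hF : MemLp F 2 (volume.restrict U)) : IsWeakSolution U A B c α f F u := by
  have := h.isFiniteMeasure
  have hG := hu.weakGradient_ae_eq h.isOpen
  have hu' := hu.congr_ae Filter.EventuallyEq.rfl hG
  refine ⟨hu.memH10 h.isOpen, fun φ hφ => ⟨h.integrable_weakIntegrand hd hs hu' hφ,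
    (hφ.integrable_mul hf).add (hφ.integrable_inner hF), ?_⟩⟩
  rw [← hw φ hφ]
  refine integral_congr_ae ?_
  filter_upwards [hG] with x hx
  rw [hx]

lemma WeakFormulation.sub (hw : WeakFormulation U A B c α f F u G)
    (hw' : WeakFormulation U A B c α f' F' v G')
    (h : CoefficientAssumptions s lam U A B c) (hd : 2 ≤ d) (hs : IsLowerSobolevExponent d s)
    (hu : HasH10Gradient U u G) (hv : HasH10Gradient U v G')
    (hf : Integrable f (volume.restrict U)) (hf' : Integrable f' (volume.restrict U))
    (hF : MemLp F 2 (volume.restrict U)) (hF' : MemLp F' 2 (volume.restrict U)) :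
    WeakFormulation U A B c α (f - f') (F - F') (u - v) (G - G') := by
  intro φ hφ
  refine (h.integral_weakIntegrand_sub hd hs hu hv hφ).trans ?_
  refine (congrArg₂ (· - ·) (hw φ hφ) (hw' φ hφ)).trans ?_
  refine (integral_sub ((hφ.integrable_mul hf).add (hφ.integrable_inner hF))
    ((hφ.integrable_mul hf').add (hφ.integrable_inner hF'))).symm.trans ?_
  congr 1 with x
  simp only [Pi.sub_apply, Pi.add_apply, inner_sub_left]
  ring

/-- The difference cannot be inserted as a test function, but it solves the problem with zero data,
and the `L^∞` bound for any one `q > d/2` makes it vanish. -/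
lemma IsWeakSolution.ae_eq (hu : IsWeakSolution U A B c α f F u)
    (hv : IsWeakSolution U A B c α f F v) (h : CoefficientAssumptions s lam U A B c)
    (hlam : 0 < lam) (hα : 0 ≤ α) (hd : 2 ≤ d) (hs : IsLowerSobolevExponent d s)
    (hf : Integrable f (volume.restrict U)) (hF : MemLp F 2 (volume.restrict U)) :
    u =ᵐ[volume.restrict U] v := by
  have pu := hu.hasH10Gradient h
  have pv := hv.hasH10Gradient h
  have hw := hu.weakFormulation.sub hv.weakFormulation h hd hs pu pv hf hf hF hF
  rw [sub_self, sub_self] at hw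
  obtain ⟨M, -, hM⟩ := WeakFormulation.exists_eLpNorm_top_le hd hlam (volume U).toNNReal
    (q := (d : ℝ) / 2 + 1) (by linarith)
  have := hM U A B c α s 0 (u - v) 0 _
    (ENNReal.coe_toNNReal h.isBounded.measure_lt_top.ne).symm h hα hs MemLp.zero MemLp.zero
    (pu.sub pv) hw
  simp only [eLpNorm_zero, add_zero, mul_zero, nonpos_iff_eq_zero] at this
  rw [eLpNorm_eq_zero_iff (pu.sub pv).memLp.1 (by simp)] at this
  filter_upwards [this] with x hx
  exact sub_eq_zero.1 hx

end WellPosedness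

theorem theorem1p1 (d : ℕ) (hd : 2 ≤ d) (lam : ℝ) (hlam : 0 < lam) (V : ℝ≥0) :
    -- `C₂` depends only on `d`, `lam`, `|U| = V` and `q`
    ∃ C₂ : ℝ → ℝ≥0, (∀ q : ℝ, (d : ℝ) / 2 < q → 0 < C₂ q) ∧
    -- `s` is the fixed exponent `2_*`
    ∀ s : ℝ, IsLowerSobolevExponent d s →
    -- `C₁` depends only on `d`, `lam`, `|U| = V` and the fixed exponent `2_*`
    ∃ C₁ : ℝ≥0, 0 < C₁ ∧
    ∀ (U : Set (EuclideanSpace ℝ (Fin d)))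
      (A : EuclideanSpace ℝ (Fin d) → Matrix (Fin d) (Fin d) ℝ)
      (B : EuclideanSpace ℝ (Fin d) → EuclideanSpace ℝ (Fin d))
      (c : EuclideanSpace ℝ (Fin d) → ℝ) (α : ℝ),
      volume U = (V : ℝ≥0∞) → CoefficientAssumptions s lam U A B c → 0 ≤ α →
      -- (i) existence, uniqueness, energy estimate and boundedness
      (∀ (f : EuclideanSpace ℝ (Fin d) → ℝ)
          (F : EuclideanSpace ℝ (Fin d) → EuclideanSpace ℝ (Fin d)),
        MemLp f (ENNReal.ofReal s) (volume.restrict U) →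
        MemLp F 2 (volume.restrict U) →
        ∃ u : EuclideanSpace ℝ (Fin d) → ℝ,
          IsWeakSolution U A B c α f F u ∧
          (∀ v : EuclideanSpace ℝ (Fin d) → ℝ, IsWeakSolution U A B c α f F v →
            v =ᵐ[volume.restrict U] u) ∧
          h1Norm U u ≤ C₁ * (eLpNorm f (ENNReal.ofReal s) (volume.restrict U)
            + eLpNorm F 2 (volume.restrict U)) ∧
          ∀ q : ℝ, (d : ℝ) / 2 < q → s ≤ q →
            MemLp f (ENNReal.ofReal q) (volume.restrict U) →
            MemLp F (ENNReal.ofReal (2 * q)) (volume.restrict U) →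
            MemLp u ∞ (volume.restrict U) ∧
            eLpNorm u ∞ (volume.restrict U)
              ≤ C₂ q * (eLpNorm f (ENNReal.ofReal q) (volume.restrict U)
                + eLpNorm F (ENNReal.ofReal (2 * q)) (volume.restrict U))) ∧
      -- (ii) contraction properties, for the weak solution of (i)
      (0 < α → ∀ (r : ℝ≥0∞) (q : ℝ), 1 ≤ r → (d : ℝ) / 2 < q →
        ∀ (f : EuclideanSpace ℝ (Fin d) → ℝ)
          (F : EuclideanSpace ℝ (Fin d) → EuclideanSpace ℝ (Fin d)),
        MemLp f r (volume.restrict U) →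
        MemLp f (ENNReal.ofReal s) (volume.restrict U) →
        MemLp F (ENNReal.ofReal (2 * q)) (volume.restrict U) →
        ∀ u : EuclideanSpace ℝ (Fin d) → ℝ, IsWeakSolution U A B c α f F u →
          MemLp u r (volume.restrict U) ∧
          eLpNorm u r (volume.restrict U)
            ≤ ENNReal.ofReal α⁻¹ * eLpNorm f r (volume.restrict U)
              + C₂ q * volume U ^ (1 / r).toReal
                * eLpNorm F (ENNReal.ofReal (2 * q)) (volume.restrict U)) := by

  classical
  choose M hM0 hM using fun q : {q : ℝ // (d : ℝ) / 2 < q} =>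
    WeakFormulation.exists_eLpNorm_top_le hd hlam V q.2
  -- The value `1` outside the range of `q` is never used.
  refine ⟨fun q => if hq : (d : ℝ) / 2 < q then M ⟨q, hq⟩ else 1, fun q hq => ?_, fun s hs => ?_⟩
  · simp only [dif_pos hq]; exact hM0 _
  have hd' : (2 : ℝ) ≤ d := by exact_mod_cast hd
  obtain ⟨C, hC⟩ := exists_sobolev_const hd V hs.two_le_conj hs.le_one_div_conj
  obtain ⟨P, hP⟩ := exists_sobolev_const hd V (p := 2) le_rfl
    (by have : 0 < 1 / (d : ℝ) := by positivity
        linarith)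
  -- `P + d` passes from the gradient norm to the `H^{1,2}` norm, with `P` the Poincaré constant;
  -- `lam⁻¹(C + 1)` comes from the energy estimate; the last `1` makes positivity immediate.
  refine ⟨(P + d) * (lam⁻¹.toNNReal * (C + 1)) + 1, by positivity, ?_⟩
  intro U A B c α hV h hα
  have := h.isFiniteMeasure
  have hUm := h.isOpen.measurableSet
  constructor
  · intro f F hf hF
    have hf1 : Integrable f (volume.restrict U) := hf.integrable hs.one_le_ofReal
    obtain ⟨u, G, hu, hw, hG⟩ := h.exists_weakFormulation hlam hα hd hs (C := C)
      (fun φ hφ => hC U hUm hV _ _ hφ.hasH10Gradient) hf hF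
    have hsol := hw.isWeakSolution h hd hs hu hf1 hF
    refine ⟨u, hsol, fun v hv => hv.ae_eq hsol h hlam hα hd hs hf1 hF, ?_, ?_⟩
    · have h2 := hP U hUm hV u G hu
      rw [ENNReal.ofReal_ofNat] at h2
      set a := eLpNorm f (ENNReal.ofReal s) (volume.restrict U)
      set b := eLpNorm F 2 (volume.restrict U)
      have hab : C * a + b ≤ (C + 1) * (a + b) := by
        rw [add_mul, one_mul, mul_add, add_assoc]
        gcongr
        exact le_add_self.trans le_add_self
      calc h1Norm U u ≤ eLpNorm u 2 (volume.restrict U) + d * eLpNorm G 2 (volume.restrict U) :=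
            h1Norm_le (hu.weakGradient_ae_eq h.isOpen)
        _ ≤ (P + d) * eLpNorm G 2 (volume.restrict U) := by rw [add_mul]; gcongr
        _ ≤ (P + d) * (ENNReal.ofReal lam⁻¹ * ((C + 1) * (a + b))) := by
            gcongr
            exact hG.trans (by gcongr)
        _ = ((P + d) * (lam⁻¹.toNNReal * (C + 1)) : ℝ≥0) * (a + b) := by
            rw [ENNReal.ofReal]; push_cast; ring
        _ ≤ _ := by
            gcongr
            exact le_self_add
    · intro q hq _ hfq hFq
      have hb := hM ⟨q, hq⟩ U A B c α s f u F G hV h hα hs hfq hFq hu hw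
      simp only [dif_pos hq]
      exact ⟨⟨hu.memLp.1, hb.trans_lt (ENNReal.mul_lt_top ENNReal.coe_lt_top
        (ENNReal.add_lt_top.2 ⟨hfq.2, hFq.2⟩))⟩, hb⟩
  · intro hα0 r q hr hq f F hfr hfs hFq u hsol
    have hf1 : Integrable f (volume.restrict U) := hfs.integrable hs.one_le_ofReal
    have hF : MemLp F 2 (volume.restrict U) := hFq.mono_exponent (by
      rw [show (2 : ℝ≥0∞) = ENNReal.ofReal 2 by simp]
      exact ENNReal.ofReal_le_ofReal (by linarith))
    have hu := hsol.hasH10Gradient h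
    -- `v` carries all of `F` and none of `f`: it is bounded by `C₂(q)‖F‖`, while `u - v` solves the
    -- problem with right-hand side `f` alone and obeys the contraction.
    obtain ⟨v, G, hv, hw, -⟩ := h.exists_weakFormulation hlam hα hd hs (C := C) (f := 0)
      (fun φ hφ => hC U hUm hV _ _ hφ.hasH10Gradient) MemLp.zero hF
    have hvb := hM ⟨q, hq⟩ U A B c α s 0 v F G hV h hα hs MemLp.zero hFq hv hw
    rw [eLpNorm_zero, zero_add] at hvb
    have hdiff := hsol.weakFormulation.sub hw h hd hs hu hv hf1 (integrable_zero _ _ _) hF hF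
    rw [sub_zero, sub_self] at hdiff
    have hub := hdiff.eLpNorm_le h hlam hα0 hd hs (hu.sub hv) hf1 hr
    have hvr : eLpNorm v r (volume.restrict U)
        ≤ eLpNorm v ⊤ (volume.restrict U) * volume U ^ (1 / r).toReal := by
      have := eLpNorm_le_eLpNorm_mul_rpow_measure_univ (le_top : r ≤ ⊤) hv.memLp.1
      simpa using this
    have hfinal : eLpNorm u r (volume.restrict U)
        ≤ ENNReal.ofReal α⁻¹ * eLpNorm f r (volume.restrict U)
          + M ⟨q, hq⟩ * volume U ^ (1 / r).toReal
            * eLpNorm F (ENNReal.ofReal (2 * q)) (volume.restrict U) := by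
      calc eLpNorm u r (volume.restrict U) = eLpNorm ((u - v) + v) r (volume.restrict U) := by
            rw [sub_add_cancel]
        _ ≤ eLpNorm (u - v) r (volume.restrict U) + eLpNorm v r (volume.restrict U) :=
            eLpNorm_add_le (hu.sub hv).memLp.1 hv.memLp.1 hr
        _ ≤ ENNReal.ofReal α⁻¹ * eLpNorm f r (volume.restrict U)
            + M ⟨q, hq⟩ * eLpNorm F (ENNReal.ofReal (2 * q)) (volume.restrict U)
              * volume U ^ (1 / r).toReal := by
            gcongr
            exact hvr.trans (by gcongr)
        _ = _ := by ring
    simp only [dif_pos hq]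
    refine ⟨⟨hu.memLp.1, hfinal.trans_lt ?_⟩, hfinal⟩
    have hpow : volume U ^ (1 / r).toReal < ⊤ :=
      ENNReal.rpow_lt_top_of_nonneg ENNReal.toReal_nonneg h.isBounded.measure_lt_top.ne
    exact ENNReal.add_lt_top.2 ⟨ENNReal.mul_lt_top ENNReal.ofReal_lt_top hfr.2,
      ENNReal.mul_lt_top (ENNReal.mul_lt_top ENNReal.coe_lt_top hpow) hFq.2⟩
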